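/- Let $M$ be a smooth manifold of dimension $2n+1$ with an almost contact structure $(\varphi,\xi,\eta)$: a smooth field of endomorphisms $\varphi$ of the tangent spaces, a smooth vector field $\xi$ and a smooth 1-form $\eta$ with $$\varphi\xi=0,\qquad \varphi^2=-\mathrm{Id}+\eta\otimes\xi,\qquad \eta\circ\varphi=0,\qquad \eta(\xi)=1.$$ Let $g$ be a smooth pseudo-Riemannian metric on $M$ with $g(\varphi x,\varphi y)=-g(x,y)+\eta(x)\eta(y)$ (such a metric necessarily has signature $(n+1,n)$), let $\nabla$ be its Levi-Civita connection, and put $F(x,y,z)=g((\nabla_x\varphi)y,z)$. Assume that $(M,\varphi,\xi,\eta,g)$ is *Sasaki-like*, that is, for all $X,Y,Z\in\ker\eta$, $$F(X,Y,Z)=F(\xi,Y,Z)=F(\xi,\xi,Z)=0,\qquad F(X,Y,\xi)=-g(X,Y).$$ Then the following hold. (a) The structure is normal: on $M\times(\mathbb R\setminus\{0\})$, with coordinate $r$ on the second factor, the almost complex structure $\check J$ given by $\check JX=\varphi X$ for $X\in\ker\eta$, $\check J\xi=r\,\partial_r$, $\check J\partial_r=-\tfrac1r\,\xi$ is integrable,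 in the sense that its Nijenhuis torsion vanishes. Moreover $N=0$, where $N=[\varphi,\varphi]+\mathrm d\eta\otimes\xi$ with $$[\varphi,\varphi](x,y)=[\varphi x,\varphi y]+\varphi^2[x,y]-\varphi[\varphi x,y]-\varphi[x,\varphi y],\qquad \mathrm d\eta(x,y)=x\,\eta(y)-y\,\eta(x)-\eta([x,y]).$$ The 1-form $\eta$ is closed, $\mathrm d\eta=0$. Finally $\nabla_\xi\xi=0$, and every integral curve of $\xi$ is a geodesic of $g$. (b) At every point $p\in M$ and for every basis $e_1,\dots,e_n,\ e_{n+1}=\varphi e_1,\dots,e_{2n}=\varphi e_n$ of $\ker\eta_p$ that is orthonormal, in the sense that $g(e_i,e_j)=\varepsilon_i\delta_{ij}$ with $\varepsilon_i=1$ for $i\le n$ and $\varepsilon_i=-1$ for $i>n$, the 1-forms $$\theta(z)=\sum_{i=1}^{2n}\varepsilon_iF(e_i,e_i,z),\qquad \theta^*(z)=\sum_{i=1}^{2n}\varepsilon_iF(e_i,\varphi e_i,z)$$ satisfy $\theta=-2n\,\eta$ and $\theta^*=0$. -/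

import Mathlib

open Bundle Manifold VectorField
open scoped Manifold ContDiff Bundle

noncomputable section
namespace SasakiLike

variable {E : Type*} [NormedAddCommGroup E] [NormedSpace ℝ E]
  {M : Type*} [TopologicalSpace M] [ChartedSpace E M] [IsManifold 𝓘(ℝ, E) ∞ M]

variable (E M) in
/-- A smooth pseudo-Riemannian metric on `M`: a smooth section of symmetric, nondegenerate bilinear
forms on the tangent spaces. -/
structure PseudoRiemannianMetric where
  val : ∀ p : M, TangentSpace 𝓘(ℝ, E) p →L[ℝ] TangentSpace 𝓘(ℝ, E) p →L[ℝ] ℝ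
  symm : ∀ (p : M) (u v : TangentSpace 𝓘(ℝ, E) p), val p u v = val p v u
  nondegenerate : ∀ (p : M) (u : TangentSpace 𝓘(ℝ, E) p), (∀ v, val p u v = 0) → u = 0
  smooth : ContMDiff 𝓘(ℝ, E) (𝓘(ℝ, E).prod 𝓘(ℝ, E →L[ℝ] E →L[ℝ] ℝ)) ∞
    (fun p ↦ TotalSpace.mk' (E →L[ℝ] E →L[ℝ] ℝ)
      (E := fun p : M ↦ TangentSpace 𝓘(ℝ, E) p →L[ℝ] TangentSpace 𝓘(ℝ, E) p →L[ℝ] ℝ) p (val p))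

instance [FiniteDimensional ℝ E] (p : M) : FiniteDimensional ℝ (TangentSpace 𝓘(ℝ, E) p) :=
  inferInstanceAs (FiniteDimensional ℝ E)

instance (p : M) : T2Space (TangentSpace 𝓘(ℝ, E) p) := inferInstanceAs (T2Space E)

namespace PseudoRiemannianMetric

variable (g : PseudoRiemannianMetric E M)

lemma mdifferentiableAt_val {X Y : ∀ p : M, TangentSpace 𝓘(ℝ, E) p} {p : M}
    (hX : MDiffAt (T% X) p) (hY : MDiffAt (T% Y) p) :
    MDiffAt (fun q ↦ g.val q (X q) (Y q)) p := by
  have h := (g.smooth p).mdifferentiableAt (by simp)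
  have := MDifferentiableAt.clm_bundle_apply₂ (F₁ := E) (F₂ := E) (F₃ := ℝ)
    (E₃ := Bundle.Trivial M ℝ) h hX hY
  rw [mdifferentiableAt_totalSpace] at this
  exact this.2

/-- The right-hand side of the Koszul formula,
`X g(Y, Z) + Y g(Z, X) - Z g(X, Y) + g([X, Y], Z) - g([Y, Z], X) + g([Z, X], Y)`. -/
def koszul (X Y Z : ∀ p : M, TangentSpace 𝓘(ℝ, E) p) (p : M) : ℝ :=
  mvfderiv 𝓘(ℝ, E) (fun q ↦ g.val q (Y q) (Z q)) p (X p)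
    + mvfderiv 𝓘(ℝ, E) (fun q ↦ g.val q (Z q) (X q)) p (Y p)
    - mvfderiv 𝓘(ℝ, E) (fun q ↦ g.val q (X q) (Y q)) p (Z p)
    + g.val p (mlieBracket 𝓘(ℝ, E) X Y p) (Z p)
    - g.val p (mlieBracket 𝓘(ℝ, E) Y Z p) (X p)
    + g.val p (mlieBracket 𝓘(ℝ, E) Z X p) (Y p)

lemma ext_val {p : M} {u v : TangentSpace 𝓘(ℝ, E) p}
    (h : ∀ Z : ∀ p : M, TangentSpace 𝓘(ℝ, E) p, MDiffAt (T% Z) p →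
      2 * g.val p u (Z p) = 2 * g.val p v (Z p)) : u = v := by
  rw [← sub_eq_zero]
  refine g.nondegenerate p _ fun w ↦ ?_
  have := h (FiberBundle.extend E w) (FiberBundle.mdifferentiableAt_extend ..)
  simp at this
  simp [this]

variable [FiniteDimensional ℝ E]

lemma koszul_tensorial_left {Y Z : ∀ p : M, TangentSpace 𝓘(ℝ, E) p} {p : M}
    (hY : MDiffAt (T% Y) p) (hZ : MDiffAt (T% Z) p) :
    TensorialAt 𝓘(ℝ, E) E (fun X ↦ g.koszul X Y Z p) p where
  smul {f X} hf hX := by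
    have := FiniteDimensional.complete ℝ E
    have h1 : (fun q ↦ g.val q (Z q) ((f • X) q)) = fun q ↦ f q * g.val q (Z q) (X q) := by
      ext q; simp
    have h2 : (fun q ↦ g.val q ((f • X) q) (Y q)) = fun q ↦ f q * g.val q (X q) (Y q) := by
      ext q; simp
    simp only [koszul, h1, h2]
    rw [mvfderiv_fun_mul hf (g.mdifferentiableAt_val hZ hX),
      mvfderiv_fun_mul hf (g.mdifferentiableAt_val hX hY), mlieBracket_smul_left hf hX,
      mlieBracket_smul_right hf hX]
    simp [g.symm p (Z p) (X p)]
    ring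
  add {X X'} hX hX' := by
    have := FiniteDimensional.complete ℝ E
    have h1 : (fun q ↦ g.val q (Z q) ((X + X') q)) =
        fun q ↦ g.val q (Z q) (X q) + g.val q (Z q) (X' q) := by
      ext q; simp
    have h2 : (fun q ↦ g.val q ((X + X') q) (Y q)) =
        fun q ↦ g.val q (X q) (Y q) + g.val q (X' q) (Y q) := by
      ext q; simp
    simp only [koszul, h1, h2]
    rw [mvfderiv_fun_add (g.mdifferentiableAt_val hZ hX) (g.mdifferentiableAt_val hZ hX'),
      mvfderiv_fun_add (g.mdifferentiableAt_val hX hY) (g.mdifferentiableAt_val hX' hY),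
      mlieBracket_add_left hX hX', mlieBracket_add_right hX hX']
    simp
    ring

lemma koszul_tensorial_right {X Y : ∀ p : M, TangentSpace 𝓘(ℝ, E) p} {p : M}
    (hX : MDiffAt (T% X) p) (hY : MDiffAt (T% Y) p) :
    TensorialAt 𝓘(ℝ, E) E (fun Z ↦ g.koszul X Y Z p) p where
  smul {f Z} hf hZ := by
    have := FiniteDimensional.complete ℝ E
    have h1 : (fun q ↦ g.val q ((f • Z) q) (X q)) = fun q ↦ f q * g.val q (Z q) (X q) := by
      ext q; simp
    have h2 : (fun q ↦ g.val q (Y q) ((f • Z) q)) = fun q ↦ f q * g.val q (Y q) (Z q) := by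
      ext q; simp
    simp only [koszul, h1, h2]
    rw [mvfderiv_fun_mul hf (g.mdifferentiableAt_val hZ hX),
      mvfderiv_fun_mul hf (g.mdifferentiableAt_val hY hZ), mlieBracket_smul_left hf hZ,
      mlieBracket_smul_right hf hZ]
    simp [g.symm p (Z p) _]
    ring
  add {Z Z'} hZ hZ' := by
    have := FiniteDimensional.complete ℝ E
    have h1 : (fun q ↦ g.val q ((Z + Z') q) (X q)) =
        fun q ↦ g.val q (Z q) (X q) + g.val q (Z' q) (X q) := by
      ext q; simp
    have h2 : (fun q ↦ g.val q (Y q) ((Z + Z') q)) =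
        fun q ↦ g.val q (Y q) (Z q) + g.val q (Y q) (Z' q) := by
      ext q; simp
    simp only [koszul, h1, h2]
    rw [mvfderiv_fun_add (g.mdifferentiableAt_val hZ hX) (g.mdifferentiableAt_val hZ' hX),
      mvfderiv_fun_add (g.mdifferentiableAt_val hY hZ) (g.mdifferentiableAt_val hY hZ'),
      mlieBracket_add_left hZ hZ', mlieBracket_add_right hZ hZ']
    simp
    ring

lemma koszul_add_middle {X Y Y' Z : ∀ p : M, TangentSpace 𝓘(ℝ, E) p} {p : M}
    (hX : MDiffAt (T% X) p) (hY : MDiffAt (T% Y) p) (hY' : MDiffAt (T% Y') p)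
    (hZ : MDiffAt (T% Z) p) :
    g.koszul X (Y + Y') Z p = g.koszul X Y Z p + g.koszul X Y' Z p := by
  have := FiniteDimensional.complete ℝ E
  have h1 : (fun q ↦ g.val q ((Y + Y') q) (Z q)) =
      fun q ↦ g.val q (Y q) (Z q) + g.val q (Y' q) (Z q) := by
    ext q; simp
  have h2 : (fun q ↦ g.val q (X q) ((Y + Y') q)) =
      fun q ↦ g.val q (X q) (Y q) + g.val q (X q) (Y' q) := by
    ext q; simp
  simp only [koszul, h1, h2]
  rw [mvfderiv_fun_add (g.mdifferentiableAt_val hY hZ) (g.mdifferentiableAt_val hY' hZ),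
    mvfderiv_fun_add (g.mdifferentiableAt_val hX hY) (g.mdifferentiableAt_val hX hY'),
    mlieBracket_add_left hY hY', mlieBracket_add_right hY hY']
  simp
  ring

lemma koszul_smul_middle {f : M → ℝ} {X Y Z : ∀ p : M, TangentSpace 𝓘(ℝ, E) p} {p : M}
    (hf : MDiffAt f p) (hX : MDiffAt (T% X) p) (hY : MDiffAt (T% Y) p)
    (hZ : MDiffAt (T% Z) p) :
    g.koszul X (f • Y) Z p =
      f p * g.koszul X Y Z p + 2 * mvfderiv 𝓘(ℝ, E) f p (X p) * g.val p (Y p) (Z p) := by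
  have := FiniteDimensional.complete ℝ E
  have h1 : (fun q ↦ g.val q ((f • Y) q) (Z q)) = fun q ↦ f q * g.val q (Y q) (Z q) := by
    ext q; simp
  have h2 : (fun q ↦ g.val q (X q) ((f • Y) q)) = fun q ↦ f q * g.val q (X q) (Y q) := by
    ext q; simp
  simp only [koszul, h1, h2]
  rw [mvfderiv_fun_mul hf (g.mdifferentiableAt_val hY hZ),
    mvfderiv_fun_mul hf (g.mdifferentiableAt_val hX hY), mlieBracket_smul_left hf hY,
    mlieBracket_smul_right hf hY]
  simp [g.symm p (X p) (Y p)]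
  ring

/-- The musical isomorphism `u ↦ g(u, ·)` at the point `p`. -/
def flat (p : M) :
    TangentSpace 𝓘(ℝ, E) p ≃L[ℝ] (TangentSpace 𝓘(ℝ, E) p →L[ℝ] ℝ) :=
  (LinearMap.linearEquivOfInjective (g.val p).toLinearMap
    ((injective_iff_map_eq_zero _).2 fun u hu ↦ g.nondegenerate p u fun v ↦
      congr($hu v))
    ((Subspace.dual_finrank_eq (K := ℝ) (V := TangentSpace 𝓘(ℝ, E) p)).symm.trans
      (LinearMap.toContinuousLinearMap (𝕜 := ℝ)
        (E := TangentSpace 𝓘(ℝ, E) p) (F' := ℝ)).finrank_eq)).toContinuousLinearEquiv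

lemma flat_apply (p : M) (u v : TangentSpace 𝓘(ℝ, E) p) : g.flat p u v = g.val p u v := rfl

open Classical in
/-- `∇Y` at `p`, as the map `u ↦ ∇_u Y`, obtained by solving the Koszul formula for `∇_u Y`
(with the value `0` where the vector field `Y` is not differentiable). -/
def leviCivitaFun (Y : ∀ p : M, TangentSpace 𝓘(ℝ, E) p) (p : M) :
    TangentSpace 𝓘(ℝ, E) p →L[ℝ] TangentSpace 𝓘(ℝ, E) p :=
  if hY : MDiffAt (T% Y) p then
    (g.flat p).symm.toContinuousLinearMap ∘L
      ((1 / 2 : ℝ) • TensorialAt.mkHom₂ (fun X Z ↦ g.koszul X Y Z p) p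
        (fun _ hZ ↦ g.koszul_tensorial_left hY hZ)
        (fun _ hX ↦ g.koszul_tensorial_right hX hY))
  else 0

lemma two_mul_val_leviCivitaFun {X Y Z : ∀ p : M, TangentSpace 𝓘(ℝ, E) p} {p : M}
    (hX : MDiffAt (T% X) p) (hY : MDiffAt (T% Y) p) (hZ : MDiffAt (T% Z) p) :
    2 * g.val p (g.leviCivitaFun Y p (X p)) (Z p) = g.koszul X Y Z p := by
  have h := TensorialAt.mkHom₂_apply (fun _ hZ ↦ g.koszul_tensorial_left hY hZ)
        (fun _ hX ↦ g.koszul_tensorial_right hX hY) hX hZ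
  rw [leviCivitaFun, dif_pos hY, ← flat_apply]
  simp only [ContinuousLinearMap.comp_apply, ContinuousLinearEquiv.coe_coe,
    ContinuousLinearEquiv.apply_symm_apply, smul_apply]
  rw [h]
  simp

/-- The Levi-Civita connection `∇` of `g`; `g.leviCivita Y p u` is `∇_u Y` at `p`. It is the torsion-free
metric connection, see `leviCivita_torsion_free` and `leviCivita_metric`. -/
def leviCivita : CovariantDerivative 𝓘(ℝ, E) E (fun p : M ↦ TangentSpace 𝓘(ℝ, E) p) where
  toFun := g.leviCivitaFun
  isCovariantDerivativeOnUniv :=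
    { add := fun {Y Y' p} hY hY' _ ↦ by
        ext u
        obtain ⟨X, hX, rfl⟩ : ∃ X : ∀ p : M, TangentSpace 𝓘(ℝ, E) p,
            MDiffAt (T% X) p ∧ X p = u :=
          ⟨FiberBundle.extend E u, FiberBundle.mdifferentiableAt_extend .., by simp⟩
        refine g.ext_val fun Z hZ ↦ ?_
        have h := mdifferentiableAt_add_section hY hY'
        rw [g.two_mul_val_leviCivitaFun hX h hZ, g.koszul_add_middle hX hY hY' hZ,
          ← g.two_mul_val_leviCivitaFun hX hY hZ, ← g.two_mul_val_leviCivitaFun hX hY' hZ]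
        simp [mul_add]
      leibniz := fun {Y f p} hY hf _ ↦ by
        ext u
        obtain ⟨X, hX, rfl⟩ : ∃ X : ∀ p : M, TangentSpace 𝓘(ℝ, E) p,
            MDiffAt (T% X) p ∧ X p = u :=
          ⟨FiberBundle.extend E u, FiberBundle.mdifferentiableAt_extend .., by simp⟩
        refine g.ext_val fun Z hZ ↦ ?_
        have h := hf.smul_section hY
        rw [g.two_mul_val_leviCivitaFun hX h hZ, g.koszul_smul_middle hf hX hY hZ,
          ← g.two_mul_val_leviCivitaFun hX hY hZ]
        simp
        ring }

theorem koszul_formula {X Y Z : ∀ p : M, TangentSpace 𝓘(ℝ, E) p} {p : M}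
    (hX : MDiffAt (T% X) p) (hY : MDiffAt (T% Y) p) (hZ : MDiffAt (T% Z) p) :
    2 * g.val p (g.leviCivita Y p (X p)) (Z p) = g.koszul X Y Z p :=
  g.two_mul_val_leviCivitaFun hX hY hZ

theorem leviCivita_torsion_free {X Y : ∀ p : M, TangentSpace 𝓘(ℝ, E) p} {p : M}
    (hX : MDiffAt (T% X) p) (hY : MDiffAt (T% Y) p) :
    g.leviCivita Y p (X p) - g.leviCivita X p (Y p) = mlieBracket 𝓘(ℝ, E) X Y p := by
  refine g.ext_val fun Z hZ ↦ ?_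
  have h1 := g.koszul_formula hX hY hZ
  have h2 := g.koszul_formula hY hX hZ
  simp only [koszul] at h1 h2
  rw [mlieBracket_swap_apply (V := Y) (W := X), mlieBracket_swap_apply (V := X) (W := Z),
    mlieBracket_swap_apply (V := Z) (W := Y)] at h2
  simp only [g.symm _ (Z _) _, g.symm _ (Y _) (X _), map_neg, map_sub, neg_apply,
    sub_apply] at h1 h2 ⊢
  linarith

theorem leviCivita_metric {X Y Z : ∀ p : M, TangentSpace 𝓘(ℝ, E) p} {p : M}
    (hX : MDiffAt (T% X) p) (hY : MDiffAt (T% Y) p) (hZ : MDiffAt (T% Z) p) :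
    mvfderiv 𝓘(ℝ, E) (fun q ↦ g.val q (Y q) (Z q)) p (X p) =
      g.val p (g.leviCivita Y p (X p)) (Z p) + g.val p (Y p) (g.leviCivita Z p (X p)) := by
  have h1 := g.koszul_formula hX hY hZ
  have h2 := g.koszul_formula hX hZ hY
  rw [g.symm p (Y p)]
  simp only [koszul] at h1 h2
  rw [mlieBracket_swap_apply (V := Y) (W := X), mlieBracket_swap_apply (V := X) (W := Z),
    mlieBracket_swap_apply (V := Z) (W := Y)] at h2
  simp only [g.symm _ (Z _) _, g.symm _ (Y _) (X _), map_neg, neg_apply] at h1 h2 ⊢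
  linarith

end PseudoRiemannianMetric

/-- The Nijenhuis torsion `[A, A](X, Y) = [AX, AY] + A²[X, Y] - A[AX, Y] - A[X, AY]` of a field `A` of
endomorphisms of the tangent spaces of a manifold. -/
def nijenhuisTorsion {E' : Type*} [NormedAddCommGroup E'] [NormedSpace ℝ E']
    {H : Type*} [TopologicalSpace H] (I : ModelWithCorners ℝ E' H)
    {N : Type*} [TopologicalSpace N] [ChartedSpace H N]
    (A : ∀ q : N, TangentSpace I q →L[ℝ] TangentSpace I q)
    (X Y : ∀ q : N, TangentSpace I q) (q : N) : TangentSpace I q :=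
  mlieBracket I (fun r ↦ A r (X r)) (fun r ↦ A r (Y r)) q
    + A q (A q (mlieBracket I X Y q))
    - A q (mlieBracket I (fun r ↦ A r (X r)) Y q)
    - A q (mlieBracket I X (fun r ↦ A r (Y r)) q)

/-- The vector field on the domain of the preferred chart at `p` whose coefficients in that chart are
the constants `v`. -/
def coordinateField (p : M) (v : E) (q : M) : TangentSpace 𝓘(ℝ, E) q :=
  (mfderiv 𝓘(ℝ, E) 𝓘(ℝ, E) (extChartAt 𝓘(ℝ, E) p) q).inverse v

/-- The covariant acceleration `D γ' / dt` at time `t`. If `c` is the expression of `γ` in the preferred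
chart at `γ t`, with coordinate fields `∂_k`, then it is
`(c^k)'' ∂_k + (c^i)' (c^j)' ∇_{∂_i} ∂_j = ((c^k)'' + Γ^k_{ij} (c^i)' (c^j)') ∂_k`. -/
def covariantAcceleration
    (nabla : CovariantDerivative 𝓘(ℝ, E) E (fun p : M ↦ TangentSpace 𝓘(ℝ, E) p))
    (γ : ℝ → M) (t : ℝ) : TangentSpace 𝓘(ℝ, E) (γ t) :=
  let c : ℝ → E := fun s ↦ extChartAt 𝓘(ℝ, E) (γ t) (γ s)
  coordinateField (γ t) (deriv (deriv c) t) (γ t)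
    + nabla (coordinateField (γ t) (deriv c t)) (γ t) (coordinateField (γ t) (deriv c t) (γ t))

/-- `γ` restricted to the open set of times `s` is a geodesic of the connection `nabla`. -/
def IsGeodesicOn
    (nabla : CovariantDerivative 𝓘(ℝ, E) E (fun p : M ↦ TangentSpace 𝓘(ℝ, E) p))
    (γ : ℝ → M) (s : Set ℝ) : Prop :=
  ContMDiffOn 𝓘(ℝ, ℝ) 𝓘(ℝ, E) ∞ γ s ∧ ∀ t ∈ s, covariantAcceleration nabla γ t = 0

variable (E M) in
/-- An almost contact structure `(φ, ξ, η)`. -/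
structure AlmostContactStructure where
  phi : ∀ p : M, TangentSpace 𝓘(ℝ, E) p →L[ℝ] TangentSpace 𝓘(ℝ, E) p
  xi : ∀ p : M, TangentSpace 𝓘(ℝ, E) p
  eta : ∀ p : M, TangentSpace 𝓘(ℝ, E) p →L[ℝ] ℝ
  phi_smooth : ContMDiff 𝓘(ℝ, E) (𝓘(ℝ, E).prod 𝓘(ℝ, E →L[ℝ] E)) ∞
    (fun p ↦ TotalSpace.mk' (E →L[ℝ] E)
      (E := fun p : M ↦ TangentSpace 𝓘(ℝ, E) p →L[ℝ] TangentSpace 𝓘(ℝ, E) p) p (phi p))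
  xi_smooth : ContMDiff 𝓘(ℝ, E) (𝓘(ℝ, E).prod 𝓘(ℝ, E)) ∞
    (fun p ↦ TotalSpace.mk' E (E := fun p : M ↦ TangentSpace 𝓘(ℝ, E) p) p (xi p))
  eta_smooth : ContMDiff 𝓘(ℝ, E) (𝓘(ℝ, E).prod 𝓘(ℝ, E →L[ℝ] ℝ)) ∞
    (fun p ↦ TotalSpace.mk' (E →L[ℝ] ℝ)
      (E := fun p : M ↦ TangentSpace 𝓘(ℝ, E) p →L[ℝ] ℝ) p (eta p))
  phi_xi : ∀ p, phi p (xi p) = 0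
  phi_phi : ∀ p u, phi p (phi p u) = -u + eta p u • xi p
  eta_phi : ∀ p u, eta p (phi p u) = 0
  eta_xi : ∀ p, eta p (xi p) = 1

namespace AlmostContactStructure

variable (S : AlmostContactStructure E M)

/-- `dη(X, Y) = X η(Y) - Y η(X) - η([X, Y])`. -/
def dEta (X Y : ∀ p : M, TangentSpace 𝓘(ℝ, E) p) (p : M) : ℝ :=
  mvfderiv 𝓘(ℝ, E) (fun q ↦ S.eta q (Y q)) p (X p)
    - mvfderiv 𝓘(ℝ, E) (fun q ↦ S.eta q (X q)) p (Y p)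
    - S.eta p (mlieBracket 𝓘(ℝ, E) X Y p)

/-- The Nijenhuis tensor `N = [φ, φ] + dη ⊗ ξ` of the almost contact structure. -/
def nijenhuis (X Y : ∀ p : M, TangentSpace 𝓘(ℝ, E) p) (p : M) : TangentSpace 𝓘(ℝ, E) p :=
  nijenhuisTorsion 𝓘(ℝ, E) S.phi X Y p + S.dEta X Y p • S.xi p

/-- The endomorphism `J` of the tangent space of `M × ℝ` at `(p, r)`, where `r ≠ 0`, with `J X = φ X` for
`X ∈ ker η`, `J ξ = r ∂/∂r` and `J (∂/∂r) = -(1/r) ξ`; that is,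
`J (u, a ∂/∂r) = (φ u - (a / r) ξ, r η(u) ∂/∂r)`. -/
def coneJ (q : M × ℝ) :
    TangentSpace (𝓘(ℝ, E).prod 𝓘(ℝ, ℝ)) q →L[ℝ] TangentSpace (𝓘(ℝ, E).prod 𝓘(ℝ, ℝ)) q :=
  let fst : TangentSpace (𝓘(ℝ, E).prod 𝓘(ℝ, ℝ)) q →L[ℝ] TangentSpace 𝓘(ℝ, E) q.1 :=
    ContinuousLinearMap.fst ℝ E ℝ
  let snd : TangentSpace (𝓘(ℝ, E).prod 𝓘(ℝ, ℝ)) q →L[ℝ] ℝ := ContinuousLinearMap.snd ℝ E ℝ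
  ContinuousLinearMap.prod (S.phi q.1 ∘L fst - (q.2⁻¹ • snd).smulRight (S.xi q.1))
    (q.2 • (S.eta q.1 ∘L fst))

/-- The almost contact structure is normal: the almost complex structure `coneJ` on
`M × (ℝ ∖ {0})` is integrable, i.e. its Nijenhuis torsion vanishes. -/
def IsNormal : Prop :=
  ∀ (q : M × ℝ), q.2 ≠ 0 →
    ∀ X Y : ∀ q : M × ℝ, TangentSpace (𝓘(ℝ, E).prod 𝓘(ℝ, ℝ)) q,
      ContMDiffAt (𝓘(ℝ, E).prod 𝓘(ℝ, ℝ)) (𝓘(ℝ, E).prod 𝓘(ℝ, ℝ)).tangent ∞ (T% X) q →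
      ContMDiffAt (𝓘(ℝ, E).prod 𝓘(ℝ, ℝ)) (𝓘(ℝ, E).prod 𝓘(ℝ, ℝ)).tangent ∞ (T% Y) q →
      nijenhuisTorsion (𝓘(ℝ, E).prod 𝓘(ℝ, ℝ)) S.coneJ X Y q = 0

end AlmostContactStructure

variable (E M) in
/-- An almost contact complex Riemannian manifold (almost contact B-metric manifold)
`(M, φ, ξ, η, g)`. The signature of `g` is automatically `(n + 1, n)`, see `exists_isAdaptedBasis`. -/
structure AlmostContactComplexRiemannian extends AlmostContactStructure E M where
  g : PseudoRiemannianMetric E M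
  compatible : ∀ p u v,
    g.val p (phi p u) (phi p v) = -g.val p u v + eta p u * eta p v

namespace AlmostContactComplexRiemannian

section

variable (S : AlmostContactComplexRiemannian E M)

lemma mdifferentiableAt_phi {Y : ∀ p : M, TangentSpace 𝓘(ℝ, E) p} {p : M}
    (hY : MDiffAt (T% Y) p) : MDiffAt (T% (fun q ↦ S.phi q (Y q))) p :=
  MDifferentiableAt.clm_bundle_apply (F₁ := E) (F₂ := E)
    ((S.phi_smooth p).mdifferentiableAt (by simp)) hY

variable [FiniteDimensional ℝ E]

lemma nablaPhi_tensorial (p : M) :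
    TensorialAt 𝓘(ℝ, E) E (fun Y ↦ S.g.leviCivita (fun q ↦ S.phi q (Y q)) p
      - S.phi p ∘L S.g.leviCivita Y p) p where
  smul {f Y} hf hY := by
    have h1 : (fun q ↦ S.phi q ((f • Y) q)) = f • fun q ↦ S.phi q (Y q) := by
      ext q; simp
    rw [h1, S.g.leviCivita.isCovariantDerivativeOnUniv.leibniz (S.mdifferentiableAt_phi hY) hf,
      S.g.leviCivita.isCovariantDerivativeOnUniv.leibniz hY hf]
    ext u
    simp [smul_sub]
  add {Y Y'} hY hY' := by
    have h1 : (fun q ↦ S.phi q ((Y + Y') q)) =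
        (fun q ↦ S.phi q (Y q)) + fun q ↦ S.phi q (Y' q) := by
      ext q; simp
    rw [h1, S.g.leviCivita.isCovariantDerivativeOnUniv.add (S.mdifferentiableAt_phi hY)
      (S.mdifferentiableAt_phi hY'), S.g.leviCivita.isCovariantDerivativeOnUniv.add hY hY']
    ext u
    simp
    abel

/-- `S.nablaPhi p v u` is `(∇_u φ) v`, the tensor induced by
`(∇_u φ) Y = ∇_u (φ Y) - φ (∇_u Y)` for vector fields `Y`. -/
def nablaPhi (p : M) :
    TangentSpace 𝓘(ℝ, E) p →L[ℝ] TangentSpace 𝓘(ℝ, E) p →L[ℝ] TangentSpace 𝓘(ℝ, E) p :=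
  TensorialAt.mkHom (fun Y ↦ S.g.leviCivita (fun q ↦ S.phi q (Y q)) p
      - S.phi p ∘L S.g.leviCivita Y p) p (S.nablaPhi_tensorial p)

theorem nablaPhi_apply {Y : ∀ p : M, TangentSpace 𝓘(ℝ, E) p} {p : M} (hY : MDiffAt (T% Y) p)
    (u : TangentSpace 𝓘(ℝ, E) p) :
    S.nablaPhi p (Y p) u =
      S.g.leviCivita (fun q ↦ S.phi q (Y q)) p u - S.phi p (S.g.leviCivita Y p u) :=
  congr($(TensorialAt.mkHom_apply (S.nablaPhi_tensorial p) hY) u)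

/-- The structure tensor `F(x, y, z) = g((∇_x φ) y, z)`. -/
def F (p : M) (x y z : TangentSpace 𝓘(ℝ, E) p) : ℝ :=
  S.g.val p (S.nablaPhi p y x) z

/-- The manifold is Sasaki-like: for all horizontal `X, Y, Z ∈ ker η`,
`F(X, Y, Z) = F(ξ, Y, Z) = F(ξ, ξ, Z) = 0` and `F(X, Y, ξ) = -g(X, Y)`. -/
def IsSasakiLike : Prop :=
  ∀ (p : M) (X Y Z : TangentSpace 𝓘(ℝ, E) p),
    S.eta p X = 0 → S.eta p Y = 0 → S.eta p Z = 0 →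
      S.F p X Y Z = 0 ∧ S.F p (S.xi p) Y Z = 0 ∧ S.F p (S.xi p) (S.xi p) Z = 0 ∧
        S.F p X Y (S.xi p) = -S.g.val p X Y

end

/-- The signs `ε_i`: `+1` on the first `n` basis vectors and `-1` on the last `n` ones. -/
def sign {n : ℕ} : Fin n ⊕ Fin n → ℝ := Sum.elim (fun _ ↦ 1) (fun _ ↦ -1)

variable (S : AlmostContactComplexRiemannian E M)

/-- `e = (e_1, …, e_n, e_{n+1} = φ e_1, …, e_{2n} = φ e_n)` is an orthonormal system of horizontal
vectors at `p`, with `g(e_i, e_i) = ε_i`. If `M` has dimension `2n + 1` then it is a basis of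
`ker η`. -/
structure IsAdaptedBasis {n : ℕ} (p : M) (e : Fin n ⊕ Fin n → TangentSpace 𝓘(ℝ, E) p) : Prop where
  horizontal : ∀ i, S.eta p (e i) = 0
  inr_eq : ∀ i, e (Sum.inr i) = S.phi p (e (Sum.inl i))
  orthonormal : ∀ i j, S.g.val p (e i) (e j) = if i = j then sign i else 0

/-- Adapted bases exist at every point. -/
theorem exists_isAdaptedBasis [FiniteDimensional ℝ E] {n : ℕ}
    (hn : Module.finrank ℝ E = 2 * n + 1) (p : M) :
    ∃ e : Fin n ⊕ Fin n → TangentSpace 𝓘(ℝ, E) p, S.IsAdaptedBasis p e := by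
  suffices h : ∀ k ≤ n, ∃ e : Fin k → TangentSpace 𝓘(ℝ, E) p, (∀ i, S.eta p (e i) = 0) ∧
      (∀ i j, S.g.val p (e i) (e j) = if i = j then 1 else 0) ∧
      ∀ i j, S.g.val p (e i) (S.phi p (e j)) = 0 by
    obtain ⟨e, h1, h2, h3⟩ := h n le_rfl
    refine ⟨Sum.elim e fun i ↦ S.phi p (e i), ⟨?_, fun _ ↦ rfl, ?_⟩⟩
    · rintro (i | i)
      · exact h1 i
      · exact S.eta_phi p _
    · rintro (i | i) (j | j)
      · simp [h2, sign]
      · simp [h3]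
      · simp [h3, S.g.symm p (S.phi p _) _]
      · simp only [Sum.elim_inr, S.compatible, h1, h2, sign, Sum.inr.injEq]
        split_ifs <;> simp
  have hphi : ∀ u v, S.g.val p (S.phi p u) v = S.g.val p u (S.phi p v) := by
    intro u v
    have h1 := S.compatible p u (S.phi p v)
    have h2 : S.eta p (S.phi p v) = 0 := S.eta_phi p v
    have h3 := S.compatible p (S.xi p) (S.phi p u)
    rw [S.phi_phi, h2] at h1
    rw [S.phi_xi, S.eta_phi] at h3
    simp [S.g.symm p (S.phi p u) (S.xi p)] at h1 h3
    rw [h3] at h1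
    linarith
  intro k
  induction k with
  | zero => exact fun _ ↦ ⟨Fin.elim0, fun i ↦ i.elim0, fun i ↦ i.elim0, fun i ↦ i.elim0⟩
  | succ k ih =>
    intro hk
    obtain ⟨e, h1, h2, h3⟩ := ih (by omega)
    -- the orthogonal complement of the vectors found so far contains `w ≠ 0`
    let L : TangentSpace 𝓘(ℝ, E) p →ₗ[ℝ] ℝ × (Fin k → ℝ) × (Fin k → ℝ) :=
      (S.eta p).toLinearMap.prod ((LinearMap.pi fun i ↦ (S.g.val p (e i)).toLinearMap).prod
        (LinearMap.pi fun i ↦ (S.g.val p (S.phi p (e i))).toLinearMap))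
    have hL : ∀ x, L x = 0 ↔ S.eta p x = 0 ∧ (∀ i, S.g.val p (e i) x = 0) ∧
        ∀ i, S.g.val p (S.phi p (e i)) x = 0 := by
      intro x
      simp [L, Prod.ext_iff, funext_iff]
    have hdim : Module.finrank ℝ (TangentSpace 𝓘(ℝ, E) p) = 2 * n + 1 := hn
    obtain ⟨w, hw, hw0⟩ := (LinearMap.ker L).exists_mem_ne_zero_of_ne_bot
      (LinearMap.ker_ne_bot_of_finrank_lt (f := L) (by simp [hdim]; omega))
    rw [LinearMap.mem_ker] at hw
    have hw' := (hL w).1 hw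
    -- it contains a vector that is not orthogonal to `w`
    obtain ⟨v, hv⟩ : ∃ v, S.g.val p w v ≠ 0 := by
      by_contra! h
      exact hw0 (S.g.nondegenerate p w h)
    have hgxi : ∀ x, S.g.val p x (S.xi p) = S.eta p x := by
      intro x
      have := S.compatible p x (S.xi p)
      rw [S.phi_xi, S.eta_xi] at this
      simp at this
      linarith
    have hxx : ∃ x, L x = 0 ∧ S.g.val p x x ≠ 0 := by
      let v' := v - S.eta p v • S.xi p - ∑ i, S.g.val p (e i) v • e i
        + ∑ i, S.g.val p (S.phi p (e i)) v • S.phi p (e i)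
      have hv' : L v' = 0 := by
        rw [hL]
        refine ⟨?_, fun j ↦ ?_, fun j ↦ ?_⟩
        · simp [v', S.eta_xi, h1, S.eta_phi]
        · simp [v', h2, h3, hgxi, h1]
        · simp [v', hphi, h1, h2, h3, S.phi_phi, S.phi_xi]
      have hwv' : S.g.val p w v' = S.g.val p w v := by
        simp [v', hgxi, hw'.1, S.g.symm p w (e _), S.g.symm p w (S.phi p (e _)), hw'.2.1, hw'.2.2]
      by_contra! h
      have a1 := h w hw
      have a2 := h v' hv'
      have a3 := h (w + v') (by rw [map_add, hw, hv', add_zero])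
      simp [a1, a2, S.g.symm p v' w, hwv'] at a3
      exact hv a3
    obtain ⟨x, hx, hxx⟩ := hxx
    have hx' := (hL x).1 hx
    -- rescale `x` by a complex number
    obtain ⟨z, hz⟩ := IsAlgClosed.exists_pow_nat_eq
      ((⟨S.g.val p x x, -S.g.val p x (S.phi p x)⟩ : ℂ)⁻¹) (n := 2) (by norm_num)
    have hZ : (⟨S.g.val p x x, -S.g.val p x (S.phi p x)⟩ : ℂ) ≠ 0 := by
      intro h
      exact hxx congr(Complex.re $h)
    have hz' : z ^ 2 * (⟨S.g.val p x x, -S.g.val p x (S.phi p x)⟩ : ℂ) = 1 := by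
      rw [hz, inv_mul_cancel₀ hZ]
    have hre := congr(Complex.re $hz')
    have him := congr(Complex.im $hz')
    simp [pow_two] at hre him
    have hφx : S.g.val p (S.phi p x) (S.phi p x) = -S.g.val p x x := by
      rw [S.compatible, hx'.1]; simp
    let y := z.re • x + z.im • S.phi p x
    have hφy : S.phi p y = z.re • S.phi p x - z.im • x := by
      simp [y, S.phi_phi, hx'.1]; abel
    have hyy : S.g.val p y y = 1 := by
      simp [y, hφx, S.g.symm p (S.phi p x) x]
      linarith
    have hyφ : S.g.val p y (S.phi p y) = 0 := by
      rw [hφy]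
      simp [y, hφx, S.g.symm p (S.phi p x) x]
      linarith
    have hey : ∀ i, S.g.val p (e i) y = 0 := by
      intro i
      simp [y, hx'.2.1, ← hphi, hx'.2.2]
    have heφ : ∀ i, S.g.val p (e i) (S.phi p y) = 0 := by
      intro i
      rw [hφy]
      simp [hx'.2.1, ← hphi, hx'.2.2]
    refine ⟨Fin.snoc e y, fun i ↦ ?_, fun i j ↦ ?_, fun i j ↦ ?_⟩
    · refine Fin.lastCases ?_ (fun i ↦ ?_) i
      · simp [y, hx'.1, S.eta_phi]
      · simp [h1]
    · refine Fin.lastCases ?_ (fun i ↦ ?_) i <;> refine Fin.lastCases ?_ (fun j ↦ ?_) j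
      · simp [hyy]
      · simp [S.g.symm p y, hey, (Fin.castSucc_lt_last j).ne']
      · simp [hey, (Fin.castSucc_lt_last i).ne]
      · simp [h2]
    · refine Fin.lastCases ?_ (fun i ↦ ?_) i <;> refine Fin.lastCases ?_ (fun j ↦ ?_) j
      · simp [hyφ]
      · simp [S.g.symm p y, hphi, heφ]
      · simp [heφ]
      · simp [h3]

/-- The 1-form `θ(z) = ∑ ε_i F(e_i, e_i, z)`, computed in the adapted basis `e`. -/
def theta [FiniteDimensional ℝ E] {n : ℕ} (p : M) (e : Fin n ⊕ Fin n → TangentSpace 𝓘(ℝ, E) p)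
    (z : TangentSpace 𝓘(ℝ, E) p) : ℝ :=
  ∑ i, sign i * S.F p (e i) (e i) z

/-- The 1-form `θ*(z) = ∑ ε_i F(e_i, φ e_i, z)`, computed in the adapted basis `e`. -/
def thetaStar [FiniteDimensional ℝ E] {n : ℕ} (p : M)
    (e : Fin n ⊕ Fin n → TangentSpace 𝓘(ℝ, E) p) (z : TangentSpace 𝓘(ℝ, E) p) : ℝ :=
  ∑ i, sign i * S.F p (e i) (S.phi p (e i)) z

end AlmostContactComplexRiemannian

end SasakiLike

end

namespace SasakiLike

section PointwiseIdentities

variable {E : Type*} [NormedAddCommGroup E] [NormedSpace ℝ E]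
  {M : Type*} [TopologicalSpace M] [ChartedSpace E M] [IsManifold 𝓘(ℝ, E) ∞ M]

namespace AlmostContactStructure

variable (S : AlmostContactStructure E M)

lemma mdifferentiableAt_xi (p : M) : MDiffAt (T% S.xi) p :=
  (S.xi_smooth p).mdifferentiableAt (by simp)

lemma mdifferentiableAt_eta_apply {Y : ∀ p : M, TangentSpace 𝓘(ℝ, E) p} {p : M}
    (hY : MDiffAt (T% Y) p) : MDiffAt (fun q ↦ S.eta q (Y q)) p := by
  have := MDifferentiableAt.clm_bundle_apply (F₁ := E) (F₂ := ℝ) (E₂ := Bundle.Trivial M ℝ)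
    ((S.eta_smooth p).mdifferentiableAt (by simp)) hY
  rw [mdifferentiableAt_totalSpace] at this
  exact this.2

end AlmostContactStructure

namespace AlmostContactComplexRiemannian

variable (S : AlmostContactComplexRiemannian E M)

lemma val_xi_right (p : M) (x : TangentSpace 𝓘(ℝ, E) p) : S.g.val p x (S.xi p) = S.eta p x := by
  have := S.compatible p x (S.xi p)
  rw [S.phi_xi, S.eta_xi] at this
  simp at this
  linarith

lemma val_xi_left (p : M) (x : TangentSpace 𝓘(ℝ, E) p) : S.g.val p (S.xi p) x = S.eta p x := by
  rw [S.g.symm, S.val_xi_right]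

lemma val_phi_left (p : M) (u v : TangentSpace 𝓘(ℝ, E) p) :
    S.g.val p (S.phi p u) v = S.g.val p u (S.phi p v) := by
  have h1 := S.compatible p u (S.phi p v)
  rw [S.phi_phi, S.eta_phi] at h1
  simp [S.val_xi_right, S.eta_phi] at h1
  linarith

variable [FiniteDimensional ℝ E]

/-- `∇φ` is symmetric with respect to `g`. -/
lemma F_comm (p : M) (x y z : TangentSpace 𝓘(ℝ, E) p) : S.F p x y z = S.F p x z y := by
  have hx : MDiffAt (T% (FiberBundle.extend E x)) p := FiberBundle.mdifferentiableAt_extend ..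
  have hy : MDiffAt (T% (FiberBundle.extend E y)) p := FiberBundle.mdifferentiableAt_extend ..
  have hz : MDiffAt (T% (FiberBundle.extend E z)) p := FiberBundle.mdifferentiableAt_extend ..
  have h1 := S.g.leviCivita_metric hx (S.mdifferentiableAt_phi hy) hz
  have h2 := S.g.leviCivita_metric hx hy (S.mdifferentiableAt_phi hz)
  have ny := S.nablaPhi_apply hy x
  have nz := S.nablaPhi_apply hz x
  simp only [FiberBundle.extend_apply_self, S.val_phi_left] at h1 h2 ny nz
  rw [h1] at h2
  rw [S.g.symm p y, S.g.symm p y (S.g.leviCivita _ p x), S.val_phi_left] at h2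
  rw [F, F, ny, nz, map_sub, sub_apply, S.val_phi_left, map_sub, sub_apply, S.val_phi_left]
  linarith

lemma nablaPhi_xi (p : M) (x : TangentSpace 𝓘(ℝ, E) p) :
    S.nablaPhi p (S.xi p) x = -S.phi p (S.g.leviCivita S.xi p x) := by
  have h : (fun q ↦ S.phi q (S.xi q)) = 0 := by
    ext q
    exact S.phi_xi q
  rw [S.nablaPhi_apply (S.mdifferentiableAt_xi p), h, CovariantDerivative.zero]
  simp

lemma F_xi_xi (p : M) (x : TangentSpace 𝓘(ℝ, E) p) : S.F p x (S.xi p) (S.xi p) = 0 := by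
  rw [F, nablaPhi_xi, S.val_xi_right, map_neg, S.eta_phi, neg_zero]

/-- `∇ξ` takes horizontal values, since `ξ` is a unit vector field. -/
lemma eta_leviCivita_xi (p : M) (x : TangentSpace 𝓘(ℝ, E) p) :
    S.eta p (S.g.leviCivita S.xi p x) = 0 := by
  have h := S.g.leviCivita_metric (FiberBundle.mdifferentiableAt_extend 𝓘(ℝ, E) E x)
    (S.mdifferentiableAt_xi p) (S.mdifferentiableAt_xi p)
  simp only [S.val_xi_right, S.val_xi_left, S.eta_xi, mvfderiv_const,
    FiberBundle.extend_apply_self] at h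
  simp only [zero_apply] at h
  linarith

lemma mvfderiv_eta_apply {X Y : ∀ p : M, TangentSpace 𝓘(ℝ, E) p} {p : M}
    (hX : MDiffAt (T% X) p) (hY : MDiffAt (T% Y) p) :
    mvfderiv 𝓘(ℝ, E) (fun q ↦ S.eta q (Y q)) p (X p) =
      S.g.val p (S.g.leviCivita S.xi p (X p)) (Y p) + S.eta p (S.g.leviCivita Y p (X p)) := by
  have h := S.g.leviCivita_metric hX (S.mdifferentiableAt_xi p) hY
  simpa only [S.val_xi_left] using h

variable {S}

lemma IsSasakiLike.F_eq (hS : S.IsSasakiLike) (p : M) (x y z : TangentSpace 𝓘(ℝ, E) p) :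
    S.F p x y z = -S.g.val p x y * S.eta p z - S.eta p y * S.g.val p x z
      + 2 * S.eta p x * S.eta p y * S.eta p z := by
  have hor (u : TangentSpace 𝓘(ℝ, E) p) : S.eta p (u - S.eta p u • S.xi p) = 0 := by
    simp [S.eta_xi]
  have dec (u : TangentSpace 𝓘(ℝ, E) p) :
      ∃ U a, S.eta p U = 0 ∧ u = U + a • S.xi p :=
    ⟨u - S.eta p u • S.xi p, S.eta p u, hor u, (sub_add_cancel u _).symm⟩
  obtain ⟨X, a, hX, rfl⟩ := dec x
  obtain ⟨Y, b, hY, rfl⟩ := dec y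
  obtain ⟨Z, c, hZ, rfl⟩ := dec z
  obtain ⟨h1, h2, h3, h4⟩ := hS p X Y Z hX hY hZ
  obtain ⟨-, -, h5, h6⟩ := hS p X Z Y hX hZ hY
  rw [S.F_comm] at h5 h6
  have h7 := S.F_xi_xi p X
  have h8 := S.F_xi_xi p (S.xi p)
  have hF (u u' v v' w w' : TangentSpace 𝓘(ℝ, E) p) (a b c : ℝ) :
      S.F p (u + a • u') (v + b • v') (w + c • w') =
        S.F p u v w + c * S.F p u v w' + b * S.F p u v' w + b * c * S.F p u v' w'
        + a * S.F p u' v w + a * c * S.F p u' v w' + a * b * S.F p u' v' w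
        + a * b * c * S.F p u' v' w' := by
    simp only [F, map_add, map_smul, add_apply, smul_apply, smul_eq_mul]
    ring
  rw [hF, h1, h2, h3, h4, h5, h6, h7, h8]
  simp only [map_add, map_smul, add_apply, smul_apply, smul_eq_mul, S.val_xi_left,
    S.val_xi_right, S.eta_xi, hX, hY, hZ]
  ring

lemma IsSasakiLike.nablaPhi_eq (hS : S.IsSasakiLike) (p : M) (x y : TangentSpace 𝓘(ℝ, E) p) :
    S.nablaPhi p y x = (2 * S.eta p x * S.eta p y - S.g.val p x y) • S.xi p - S.eta p y • x := by
  rw [← sub_eq_zero]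
  refine S.g.nondegenerate p _ fun z ↦ ?_
  have h := hS.F_eq p x y z
  rw [F] at h
  simp only [map_sub, map_smul, sub_apply, smul_apply, smul_eq_mul, S.val_xi_left, h]
  ring

lemma IsSasakiLike.leviCivita_xi (hS : S.IsSasakiLike) (p : M) (x : TangentSpace 𝓘(ℝ, E) p) :
    S.g.leviCivita S.xi p x = -S.phi p x := by
  have h := S.nablaPhi_xi p x
  rw [hS.nablaPhi_eq, S.eta_xi, S.val_xi_right] at h
  have h' := congr(S.phi p $h)
  rw [map_neg, S.phi_phi, S.eta_leviCivita_xi] at h'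
  simpa [S.phi_xi] using h'.symm

lemma IsSasakiLike.leviCivita_xi_xi (hS : S.IsSasakiLike) (p : M) :
    S.g.leviCivita S.xi p (S.xi p) = 0 := by
  rw [hS.leviCivita_xi, S.phi_xi, neg_zero]

/-- `∇_x (φ Y) = φ (∇_x Y) + (∇_x φ) Y` on a Sasaki-like manifold. -/
lemma IsSasakiLike.leviCivita_phi_apply (hS : S.IsSasakiLike)
    {Y : ∀ p : M, TangentSpace 𝓘(ℝ, E) p} {p : M} (hY : MDiffAt (T% Y) p)
    (x : TangentSpace 𝓘(ℝ, E) p) :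
    S.g.leviCivita (fun q ↦ S.phi q (Y q)) p x = S.phi p (S.g.leviCivita Y p x)
      + ((2 * S.eta p x * S.eta p (Y p) - S.g.val p x (Y p)) • S.xi p - S.eta p (Y p) • x) := by
  rw [← hS.nablaPhi_eq, S.nablaPhi_apply hY]
  abel

lemma IsSasakiLike.dEta_eq_zero (hS : S.IsSasakiLike)
    {X Y : ∀ p : M, TangentSpace 𝓘(ℝ, E) p} {p : M} (hX : MDiffAt (T% X) p)
    (hY : MDiffAt (T% Y) p) : S.dEta X Y p = 0 := by
  rw [AlmostContactStructure.dEta, S.mvfderiv_eta_apply hX hY, S.mvfderiv_eta_apply hY hX,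
    ← S.g.leviCivita_torsion_free hX hY, hS.leviCivita_xi, hS.leviCivita_xi, map_neg, map_neg,
    neg_apply, neg_apply, S.val_phi_left, S.g.symm p (S.phi p (Y p)), map_sub]
  ring

lemma IsSasakiLike.nijenhuisTorsion_phi_eq_zero (hS : S.IsSasakiLike)
    {X Y : ∀ p : M, TangentSpace 𝓘(ℝ, E) p} {p : M} (hX : MDiffAt (T% X) p)
    (hY : MDiffAt (T% Y) p) : nijenhuisTorsion 𝓘(ℝ, E) S.phi X Y p = 0 := by
  have hφX := S.mdifferentiableAt_phi hX
  have hφY := S.mdifferentiableAt_phi hY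
  rw [nijenhuisTorsion, ← S.g.leviCivita_torsion_free hφX hφY,
    ← S.g.leviCivita_torsion_free hX hY, ← S.g.leviCivita_torsion_free hφX hY,
    ← S.g.leviCivita_torsion_free hX hφY]
  simp only [hS.leviCivita_phi_apply hX, hS.leviCivita_phi_apply hY, map_add, map_sub, map_smul,
    S.eta_phi, S.phi_xi, S.val_phi_left, S.g.symm p (Y p)]
  module

lemma IsSasakiLike.nijenhuis_eq_zero (hS : S.IsSasakiLike)
    {X Y : ∀ p : M, TangentSpace 𝓘(ℝ, E) p} {p : M} (hX : MDiffAt (T% X) p)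
    (hY : MDiffAt (T% Y) p) : S.nijenhuis X Y p = 0 := by
  rw [AlmostContactStructure.nijenhuis, hS.nijenhuisTorsion_phi_eq_zero hX hY,
    hS.dEta_eq_zero hX hY, zero_smul, add_zero]

/-- The Lie derivative of `φ` along `ξ` vanishes. -/
lemma IsSasakiLike.mlieBracket_phi_xi (hS : S.IsSasakiLike)
    {X : ∀ p : M, TangentSpace 𝓘(ℝ, E) p} {p : M} (hX : MDiffAt (T% X) p) :
    mlieBracket 𝓘(ℝ, E) (fun q ↦ S.phi q (X q)) S.xi p =
      S.phi p (mlieBracket 𝓘(ℝ, E) X S.xi p) := by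
  rw [← S.g.leviCivita_torsion_free (S.mdifferentiableAt_phi hX) (S.mdifferentiableAt_xi p),
    ← S.g.leviCivita_torsion_free hX (S.mdifferentiableAt_xi p), hS.leviCivita_phi_apply hX]
  simp only [hS.leviCivita_xi, map_sub, map_neg, S.eta_xi, S.val_xi_left, S.phi_phi]
  module

lemma IsSasakiLike.theta_eq (hS : S.IsSasakiLike) {n : ℕ} {p : M}
    {e : Fin n ⊕ Fin n → TangentSpace 𝓘(ℝ, E) p} (he : S.IsAdaptedBasis p e)
    (z : TangentSpace 𝓘(ℝ, E) p) : S.theta p e z = -2 * n * S.eta p z := by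
  simp only [theta, hS.F_eq, he.orthonormal, he.horizontal]
  simp [sign]
  ring

lemma IsSasakiLike.thetaStar_eq_zero (hS : S.IsSasakiLike) {n : ℕ} {p : M}
    {e : Fin n ⊕ Fin n → TangentSpace 𝓘(ℝ, E) p} (he : S.IsAdaptedBasis p e)
    (z : TangentSpace 𝓘(ℝ, E) p) : S.thetaStar p e z = 0 := by
  refine Finset.sum_eq_zero fun i _ ↦ ?_
  have h : S.g.val p (e i) (S.phi p (e i)) = 0 := by
    rcases i with i | i
    · rw [← he.inr_eq, he.orthonormal, if_neg (by simp)]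
    · rw [he.inr_eq, S.phi_phi, he.horizontal, zero_smul, add_zero, map_neg, ← he.inr_eq,
        he.orthonormal, if_neg (by simp), neg_zero]
  rw [hS.F_eq, h, S.eta_phi, he.horizontal]
  ring

end AlmostContactComplexRiemannian
end PointwiseIdentities
section IntegralCurves

open Filter Topology

section

variable {E : Type*} [NormedAddCommGroup E] [NormedSpace ℝ E]
  {H : Type*} [TopologicalSpace H] {I : ModelWithCorners ℝ E H}
  {M : Type*} [TopologicalSpace M] [ChartedSpace H M]

variable (I) in
/-- The coefficients of a vector field in the preferred chart at `p`. -/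
noncomputable def chartCoeff (p : M) (X : ∀ q : M, TangentSpace I q) (q : M) : E :=
  mfderiv I 𝓘(ℝ, E) (extChartAt I p) q (X q)

variable [IsManifold I 1 M]

lemma chartCoeff_eventuallyEq (p : M) (X : ∀ q : M, TangentSpace I q) :
    chartCoeff I p X =ᶠ[𝓝 p] fun q ↦ (trivializationAt E (TangentSpace I) p (T% X q)).2 := by
  filter_upwards [(chartAt H p).open_source.mem_nhds (mem_chart_source H p)] with q hq
  rw [chartCoeff, ← TangentBundle.continuousLinearMapAt_trivializationAt hq]
  exact Trivialization.continuousLinearMapAt_apply_of_mem _ _ hq _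

lemma contMDiffAt_chartCoeff {n : ℕ∞ω} {X : ∀ q : M, TangentSpace I q} {p : M}
    (hX : ContMDiffAt I I.tangent n (T% X) p) :
    ContMDiffAt I 𝓘(ℝ, E) n (chartCoeff I p X) p :=
  ((contMDiffAt_section _).1 hX).congr_of_eventuallyEq (chartCoeff_eventuallyEq p X)

lemma mdifferentiableAt_iff_chartCoeff {X : ∀ q : M, TangentSpace I q} {p : M} :
    MDiffAt (T% X) p ↔ MDiffAt (chartCoeff I p X) p := by
  rw [mdifferentiableAt_section]
  exact ⟨fun h ↦ h.congr_of_eventuallyEq (chartCoeff_eventuallyEq p X),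
    fun h ↦ h.congr_of_eventuallyEq (chartCoeff_eventuallyEq p X).symm⟩

end

variable {E : Type*} [NormedAddCommGroup E] [NormedSpace ℝ E]
  {M : Type*} [TopologicalSpace M] [ChartedSpace E M] [IsManifold 𝓘(ℝ, E) ∞ M]

lemma isInvertible_mfderiv_chart {p q : M} (hq : q ∈ (chartAt E p).source) :
    (mfderiv 𝓘(ℝ, E) 𝓘(ℝ, E) (extChartAt 𝓘(ℝ, E) p) q).IsInvertible :=
  isInvertible_mfderiv_extChartAt (by simpa using hq)

lemma chartCoeff_coordinateField (p : M) (v : E) {q : M} (hq : q ∈ (chartAt E p).source) :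
    chartCoeff 𝓘(ℝ, E) p (coordinateField p v) q = v :=
  (isInvertible_mfderiv_chart hq).self_apply_inverse v

lemma coordinateField_chartCoeff {p q : M} (X : ∀ q : M, TangentSpace 𝓘(ℝ, E) q)
    (hq : q ∈ (chartAt E p).source) : coordinateField p (chartCoeff 𝓘(ℝ, E) p X q) q = X q :=
  (isInvertible_mfderiv_chart hq).inverse_apply_self _

lemma mdifferentiableAt_coordinateField (p : M) (v : E) :
    MDiffAt (T% (coordinateField p v)) p := by
  rw [mdifferentiableAt_iff_chartCoeff]
  refine (mdifferentiableAt_const (c := v)).congr_of_eventuallyEq ?_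
  filter_upwards [(chartAt E p).open_source.mem_nhds (mem_chart_source E p)] with q hq
  exact chartCoeff_coordinateField p v hq

/-- The expression of a covariant derivative in the preferred chart at `p`. -/
lemma covariantDerivative_eq_coordinateField [FiniteDimensional ℝ E]
    (nabla : CovariantDerivative 𝓘(ℝ, E) E (fun p : M ↦ TangentSpace 𝓘(ℝ, E) p))
    {X : ∀ q : M, TangentSpace 𝓘(ℝ, E) q} {p : M} (hX : MDiffAt (T% X) p)
    (u : TangentSpace 𝓘(ℝ, E) p) :
    nabla X p u = coordinateField p (mvfderiv 𝓘(ℝ, E) (chartCoeff 𝓘(ℝ, E) p X) p u) p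
      + nabla (coordinateField p (chartCoeff 𝓘(ℝ, E) p X p)) p u := by
  let b := Module.finBasis ℝ E
  let f (i) : M → ℝ := fun q ↦ (b.coord i).toContinuousLinearMap (chartCoeff 𝓘(ℝ, E) p X q)
  have hX' := mdifferentiableAt_iff_chartCoeff.1 hX
  have hf (i) : MDiffAt (f i) p :=
    (b.coord i).toContinuousLinearMap.mdifferentiableAt.comp p hX'
  have hdf (i) : mvfderiv 𝓘(ℝ, E) (f i) p u =
      b.coord i (mvfderiv 𝓘(ℝ, E) (chartCoeff 𝓘(ℝ, E) p X) p u) := by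
    have := mfderiv_comp_apply p ((b.coord i).toContinuousLinearMap.mdifferentiableAt) hX' u
    rw [ContinuousLinearMap.mfderiv_eq] at this
    exact this
  have hB (i) : MDiffAt (T% (coordinateField p (b i))) p := mdifferentiableAt_coordinateField p _
  have hsum (v : E) : coordinateField p v = fun q ↦ ∑ i, b.coord i v • coordinateField p (b i) q := by
    ext q
    let L : E →L[ℝ] TangentSpace 𝓘(ℝ, E) q :=
      (mfderiv 𝓘(ℝ, E) 𝓘(ℝ, E) (extChartAt 𝓘(ℝ, E) p) q).inverse
    calc L v = L (∑ i, b.repr v i • b i) := by rw [b.sum_repr]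
      _ = ∑ i, b.repr v i • L (b i) := by rw [map_sum]; simp only [map_smul]
  have tens := nabla.isCovariantDerivativeOnUniv
  have nsum (f : Fin (Module.finrank ℝ E) → M → ℝ) (hf : ∀ i, MDiffAt (f i) p) :
      nabla (fun q ↦ ∑ i, f i q • coordinateField p (b i) q) p u =
        ∑ i, (f i p • nabla (coordinateField p (b i)) p u +
          mvfderiv 𝓘(ℝ, E) (f i) p u • coordinateField p (b i) p) := by
    induction (Finset.univ : Finset (Fin (Module.finrank ℝ E))) using Finset.induction_on with
    | empty =>
      simp only [Finset.sum_empty]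
      exact congr($(tens.zero (x := p)) u)
    | insert i t hi ih =>
      simp only [Finset.sum_insert hi]
      rw [← ih]
      have h1 := tens.add ((hf i).smul_section (hB i))
        (.sum_section (s := t) (t := fun i ↦ f i • coordinateField p (b i))
          fun i _ ↦ (hf i).smul_section (hB i)) (x := p)
      have h2 := tens.leibniz (hB i) (hf i)
      rw [h2] at h1
      exact congr($h1 u)
  have hloc : nabla X p = nabla (fun q ↦ ∑ i, f i q • coordinateField p (b i) q) p := by
    refine tens.congr_of_eventuallyEq hX
      (.sum_section fun i _ ↦ (hf i).smul_section (hB i)) univ_mem ?_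
    filter_upwards [(chartAt E p).open_source.mem_nhds (mem_chart_source E p)] with q hq
    rw [← coordinateField_chartCoeff X hq, hsum]
    rfl
  rw [hloc, nsum f hf, hsum (chartCoeff 𝓘(ℝ, E) p X p), nsum _ fun i ↦ mdifferentiableAt_const, hsum,
    ← Finset.sum_add_distrib]
  refine Finset.sum_congr rfl fun i _ ↦ ?_
  rw [hdf, mvfderiv_const, zero_apply, zero_smul, add_zero, add_comm]
  rfl

lemma hasDerivAt_of_hasMFDerivAt {c : ℝ → E} {t : ℝ}
    {L : TangentSpace 𝓘(ℝ, ℝ) t →L[ℝ] TangentSpace 𝓘(ℝ, E) (c t)}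
    (h : HasMFDerivAt 𝓘(ℝ, ℝ) 𝓘(ℝ, E) c t L) : HasDerivAt c (L (1 : ℝ)) t := by
  have h' : HasFDerivAt c (show ℝ →L[ℝ] E from L) t := h.hasFDerivAt
  exact h'.hasDerivAt

lemma hasDerivAt_chart_of_isMIntegralCurveOn {X : ∀ q : M, TangentSpace 𝓘(ℝ, E) q} {γ : ℝ → M}
    {s : Set ℝ} (hs : IsOpen s) (hγ : IsMIntegralCurveOn γ X s) {p : M} {t : ℝ} (ht : t ∈ s)
    (hp : γ t ∈ (chartAt E p).source) :
    HasDerivAt (fun r ↦ extChartAt 𝓘(ℝ, E) p (γ r)) (chartCoeff 𝓘(ℝ, E) p X (γ t)) t := by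
  have h1 := (hγ t ht).hasMFDerivAt (hs.mem_nhds ht)
  have h2 := (mdifferentiableAt_extChartAt (I := 𝓘(ℝ, E)) hp).hasMFDerivAt.comp t h1
  refine (hasDerivAt_of_hasMFDerivAt h2).congr_deriv ?_
  exact congrArg (mfderiv 𝓘(ℝ, E) 𝓘(ℝ, E) (extChartAt 𝓘(ℝ, E) p) (γ t)) (one_smul ℝ (X (γ t)))

/-- The integral curves of a smooth vector field are smooth. -/
lemma contMDiffOn_of_isMIntegralCurveOn {X : ∀ q : M, TangentSpace 𝓘(ℝ, E) q}
    (hX : ContMDiff 𝓘(ℝ, E) 𝓘(ℝ, E).tangent ∞ (T% X)) {γ : ℝ → M}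
    {s : Set ℝ} (hs : IsOpen s) (hγ : IsMIntegralCurveOn γ X s) :
    ContMDiffOn 𝓘(ℝ, ℝ) 𝓘(ℝ, E) ∞ γ s := by
  have h (n : ℕ) : ContMDiffOn 𝓘(ℝ, ℝ) 𝓘(ℝ, E) n γ s := by
    induction n with
    | zero => exact contMDiffOn_zero_iff.2 hγ.continuousOn
    | succ n ih =>
      intro t ht
      have hγt := (ih t ht).contMDiffAt (hs.mem_nhds ht)
      refine ContMDiffAt.contMDiffWithinAt ?_
      rw [contMDiffAt_iff_target]
      refine ⟨hγt.continuousAt, ?_⟩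
      rw [contMDiffAt_iff_contDiffAt]
      push_cast
      rw [contDiffAt_succ_iff_hasFDerivAt]
      refine ⟨fun r ↦ (1 : ℝ →L[ℝ] ℝ).smulRight (chartCoeff 𝓘(ℝ, E) (γ t) X (γ r)),
        ⟨s ∩ γ ⁻¹' (chartAt E (γ t)).source, ?_, fun r hr ↦ ?_⟩, ?_⟩
      · exact inter_mem (hs.mem_nhds ht) (hγt.continuousAt.preimage_mem_nhds
          ((chartAt E (γ t)).open_source.mem_nhds (mem_chart_source E _)))
      · exact (hasDerivAt_chart_of_isMIntegralCurveOn hs hγ hr.1 hr.2).hasFDerivAt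
      · have h1 : ContDiffAt ℝ n (fun r ↦ chartCoeff 𝓘(ℝ, E) (γ t) X (γ r)) t :=
          (((contMDiffAt_chartCoeff (hX (γ t))).of_le (mod_cast le_top)).comp t hγt).contDiffAt
        exact contDiffAt_const.smulRight h1
  exact contMDiffOn_infty.2 h

/-- The integral curves of a vector field `X` with `∇_X X = 0` are geodesics. -/
lemma isGeodesicOn_of_isMIntegralCurveOn [FiniteDimensional ℝ E]
    {nabla : CovariantDerivative 𝓘(ℝ, E) E (fun p : M ↦ TangentSpace 𝓘(ℝ, E) p)}
    {X : ∀ q : M, TangentSpace 𝓘(ℝ, E) q}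
    (hX : ContMDiff 𝓘(ℝ, E) 𝓘(ℝ, E).tangent ∞ (T% X)) (h : ∀ p, nabla X p (X p) = 0) {γ : ℝ → M}
    {s : Set ℝ} (hs : IsOpen s) (hγ : IsMIntegralCurveOn γ X s) : IsGeodesicOn nabla γ s := by
  refine ⟨contMDiffOn_of_isMIntegralCurveOn hX hs hγ, fun t ht ↦ ?_⟩
  have hX' := (hX (γ t)).mdifferentiableAt (by simp)
  have hc : deriv (fun r ↦ extChartAt 𝓘(ℝ, E) (γ t) (γ r)) =ᶠ[𝓝 t]
      fun r ↦ chartCoeff 𝓘(ℝ, E) (γ t) X (γ r) := by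
    filter_upwards [hs.mem_nhds ht,
      (hγ.continuousOn.continuousAt (hs.mem_nhds ht)).preimage_mem_nhds
      ((chartAt E (γ t)).open_source.mem_nhds (mem_chart_source E _))] with r hr hr'
    exact (hasDerivAt_chart_of_isMIntegralCurveOn hs hγ hr hr').deriv
  have hc' : deriv (deriv fun r ↦ extChartAt 𝓘(ℝ, E) (γ t) (γ r)) t =
      mvfderiv 𝓘(ℝ, E) (chartCoeff 𝓘(ℝ, E) (γ t) X) (γ t) (X (γ t)) := by
    rw [hc.deriv_eq]
    have h1 := (hγ t ht).hasMFDerivAt (hs.mem_nhds ht)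
    have h2 := (mdifferentiableAt_iff_chartCoeff.1 hX').hasMFDerivAt.comp t h1
    refine ((hasDerivAt_of_hasMFDerivAt h2).congr_deriv ?_).deriv
    exact congrArg (mfderiv 𝓘(ℝ, E) 𝓘(ℝ, E) (chartCoeff 𝓘(ℝ, E) (γ t) X) (γ t)) (one_smul ℝ (X (γ t)))
  have h0 := h (γ t)
  rw [covariantDerivative_eq_coordinateField nabla hX'] at h0
  rw [covariantAcceleration]
  simp only [hc', hc.eq_of_nhds]
  rwa [coordinateField_chartCoeff X (mem_chart_source E _)]

end IntegralCurves
section LieBracket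

open Filter Topology

variable {E : Type*} [NormedAddCommGroup E] [NormedSpace ℝ E] [CompleteSpace E]
  {H : Type*} [TopologicalSpace H] {I : ModelWithCorners ℝ E H} [I.Boundaryless]
  {M : Type*} [TopologicalSpace M] [ChartedSpace H M] [IsManifold I 2 M]
  {F : Type*} [NormedAddCommGroup F] [NormedSpace ℝ F]

/-- The differentiation operator along `[X, Y]` is the commutator of the differentiation operators
along `X` and `Y`. -/
lemma mvfderiv_apply_mlieBracket {f : M → F} {X Y : ∀ q : M, TangentSpace I q} {p : M}
    (hf : ContMDiffAt I 𝓘(ℝ, F) 2 f p) (hX : MDiffAt (T% X) p) (hY : MDiffAt (T% Y) p) :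
    mvfderiv I f p (mlieBracket I X Y p) =
      mvfderiv I (fun q ↦ mvfderiv I f q (Y q)) p (X p)
        - mvfderiv I (fun q ↦ mvfderiv I f q (X q)) p (Y p) := by
  have : IsManifold I 1 M := .of_le (n := 2) (by norm_num)
  set φ := extChartAt I p
  set G : E → F := f ∘ φ.symm
  let pull (X : ∀ q : M, TangentSpace I q) : E → E :=
    mpullbackWithin 𝓘(ℝ, E) I φ.symm X (Set.range I)
  have hG : ContDiffAt ℝ 2 G (φ p) := by
    have h := (contMDiffAt_iff.1 hf).2
    rwa [I.range_eq_univ, contDiffWithinAt_univ] at h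
  have hpull {X : ∀ q : M, TangentSpace I q} (hX : MDiffAt (T% X) p) :
      DifferentiableAt ℝ (pull X) (φ p) := by
    have h := MDifferentiableWithinAt.differentiableWithinAt_mpullbackWithin_vectorField
      (mdifferentiableWithinAt_univ.2 hX)
    rw [Set.preimage_univ, Set.univ_inter] at h
    exact h.differentiableAt (by rw [I.range_eq_univ]; exact univ_mem)
  have hsrc : ∀ᶠ q in 𝓝 p, q ∈ φ.source := extChartAt_source_mem_nhds p
  have hp : p ∈ φ.source := mem_extChartAt_source p
  have hφd {q : M} (hq : q ∈ φ.source) : MDiffAt φ q :=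
    mdifferentiableAt_extChartAt (by simpa [φ] using hq)
  have hinv {q : M} (hq : q ∈ φ.source) (v : E) :
      mfderiv I 𝓘(ℝ, E) φ q ((mfderiv I 𝓘(ℝ, E) φ q).inverse v) = v :=
    (isInvertible_mfderiv_extChartAt hq).self_apply_inverse v
  have hval (X : ∀ q : M, TangentSpace I q) :
      ∀ᶠ q in 𝓝 p, mfderiv I 𝓘(ℝ, E) φ q (X q) = pull X (φ q) := by
    have h := eventuallyEq_mpullback_mpullbackWithin_extChartAt (I := I) (x := p)
      (s := Set.univ) X
    rw [nhdsWithin_univ] at h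
    filter_upwards [h, hsrc] with q hq hq'
    exact (congrArg (mfderiv I 𝓘(ℝ, E) φ q) hq).trans (hinv hq' _)
  have hcomp {g : M → F} {G' : E → F} {q : M} (hq : q ∈ φ.source)
      (hG' : DifferentiableAt ℝ G' (φ q)) (hg : g =ᶠ[𝓝 q] G' ∘ φ)
      {v : TangentSpace I q} {w : E} (hw : mfderiv I 𝓘(ℝ, E) φ q v = w) :
      mvfderiv I g q v = fderiv ℝ G' (φ q) w := by
    have h1 : mvfderiv I g q v = mfderiv I 𝓘(ℝ, F) (G' ∘ φ) q v :=
      congr($(hg.mfderiv_eq) v)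
    rw [h1, mfderiv_comp_apply q hG'.mdifferentiableAt (hφd hq), hw, mfderiv_eq_fderiv]
    rfl
  have hfG {q : M} (hq : q ∈ φ.source) : f =ᶠ[𝓝 q] G ∘ φ := by
    filter_upwards [(isOpen_extChartAt_source p).mem_nhds hq] with q' hq'
    simp only [G, Function.comp_apply, φ.left_inv hq']
  have hdG : ∀ᶠ q in 𝓝 p, DifferentiableAt ℝ G (φ q) := by
    have h : ∀ᶠ y in 𝓝 (φ p), DifferentiableAt ℝ G y :=
      (hG.eventually (by simp)).mono fun y hy ↦ hy.differentiableAt (by simp)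
    exact (continuousAt_extChartAt p).eventually h
  have hderiv (X : ∀ q : M, TangentSpace I q) :
      (fun q ↦ mvfderiv I f q (X q)) =ᶠ[𝓝 p] (fun y ↦ fderiv ℝ G y (pull X y)) ∘ φ := by
    filter_upwards [hval X, hsrc, hdG] with q hq hq' hq''
    exact hcomp hq' hq'' (hfG hq') hq
  have hH {X : ∀ q : M, TangentSpace I q} (hX : MDiffAt (T% X) p) :
      DifferentiableAt ℝ (fun y ↦ fderiv ℝ G y (pull X y)) (φ p) :=
    ((hG.fderiv_right (m := 1) (by norm_num)).differentiableAt (by simp)).clm_apply (hpull hX)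
  have hbr : mfderiv I 𝓘(ℝ, E) φ p (mlieBracket I X Y p) =
      lieBracket ℝ (pull X) (pull Y) (φ p) := by
    rw [mlieBracket, mlieBracketWithin_apply, hinv hp, Set.preimage_univ, Set.univ_inter,
      ← lieBracketWithin_univ]
    simp only [pull, φ, I.range_eq_univ]
    rfl
  rw [hcomp hp (hH hY) (hderiv Y) (hval X).self_of_nhds,
    hcomp hp (hH hX) (hderiv X) (hval Y).self_of_nhds,
    hcomp hp hdG.self_of_nhds (hfG hp) hbr,
    fderiv_apply_lieBracket hG (by simp) (hpull hY) (hpull hX)]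

variable {E' : Type*} [NormedAddCommGroup E'] [NormedSpace ℝ E'] [CompleteSpace E']
  {H' : Type*} [TopologicalSpace H'] {J : ModelWithCorners ℝ E' H'} [J.Boundaryless]
  {N : Type*} [TopologicalSpace N] [ChartedSpace H' N] [IsManifold J 2 N]

/-- The Lie brackets of `f`-related vector fields are `f`-related. -/
lemma mfderiv_apply_mlieBracket_of_related {f : M → N} {X Y : ∀ q : M, TangentSpace I q}
    {U V : ∀ q : N, TangentSpace J q} {p : M} (hf : ContMDiffAt I J 2 f p)
    (hX : MDiffAt (T% X) p) (hY : MDiffAt (T% Y) p)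
    (hU : MDiffAt (T% U) (f p)) (hV : MDiffAt (T% V) (f p))
    (hXU : ∀ᶠ q in 𝓝 p, mfderiv I J f q (X q) = U (f q))
    (hYV : ∀ᶠ q in 𝓝 p, mfderiv I J f q (Y q) = V (f q)) :
    mfderiv I J f p (mlieBracket I X Y p) = mlieBracket J U V (f p) := by
  have : IsManifold I 1 M := .of_le (n := 2) (by norm_num)
  have : IsManifold J 1 N := .of_le (n := 2) (by norm_num)
  set φ := extChartAt J (f p)
  have hφ2 : ContMDiffAt J 𝓘(ℝ, E') 2 φ (f p) := contMDiffAt_extChartAt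
  have hfd : ∀ᶠ q in 𝓝 p, MDiffAt f q :=
    ((contMDiffAt_iff_contMDiffAt_nhds (by simp)).1 hf).mono fun q hq ↦ hq.mdifferentiableAt (by simp)
  have hφd : ∀ᶠ q in 𝓝 (f p), MDiffAt φ q :=
    ((contMDiffAt_iff_contMDiffAt_nhds (by simp)).1 hφ2).mono fun q hq ↦ hq.mdifferentiableAt (by simp)
  have hfp : MDiffAt f p := hfd.self_of_nhds
  have hrel {X : ∀ q : M, TangentSpace I q} {U : ∀ q : N, TangentSpace J q}
      (h : ∀ᶠ q in 𝓝 p, mfderiv I J f q (X q) = U (f q)) :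
      (fun q ↦ mvfderiv I (φ ∘ f) q (X q)) =ᶠ[𝓝 p] (fun q ↦ mvfderiv J φ q (U q)) ∘ f := by
    filter_upwards [h, hfd, hf.continuousAt.eventually hφd] with q hq hq' hq''
    exact (mfderiv_comp_apply q hq'' hq' (X q)).trans (congrArg (mfderiv J 𝓘(ℝ, E') φ (f q)) hq)
  have hder {X Y : ∀ q : M, TangentSpace I q} {U V : ∀ q : N, TangentSpace J q}
      (hV : MDiffAt (T% V) (f p))
      (h : ∀ᶠ q in 𝓝 p, mfderiv I J f q (X q) = U (f q))
      (h' : ∀ᶠ q in 𝓝 p, mfderiv I J f q (Y q) = V (f q)) :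
      mvfderiv I (fun q ↦ mvfderiv I (φ ∘ f) q (Y q)) p (X p) =
        mvfderiv J (fun q ↦ mvfderiv J φ q (V q)) (f p) (U (f p)) := by
    have hd : MDiffAt (fun q ↦ mvfderiv J φ q (V q)) (f p) :=
      mdifferentiableAt_iff_chartCoeff.1 hV
    have h1 : mvfderiv I (fun q ↦ mvfderiv I (φ ∘ f) q (Y q)) p (X p) =
        mfderiv I 𝓘(ℝ, E') ((fun q ↦ mvfderiv J φ q (V q)) ∘ f) p (X p) :=
      congr($((hrel h').mfderiv_eq) (X p))
    exact h1.trans ((mfderiv_comp_apply p hd hfp (X p)).trans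
      (congrArg (mfderiv J 𝓘(ℝ, E') (fun q ↦ mvfderiv J φ q (V q)) (f p)) h.self_of_nhds))
  have key : mvfderiv I (φ ∘ f) p (mlieBracket I X Y p) =
      mvfderiv J φ (f p) (mlieBracket J U V (f p)) := by
    rw [mvfderiv_apply_mlieBracket (hφ2.comp p hf) hX hY, mvfderiv_apply_mlieBracket hφ2 hU hV,
      hder hV hXU hYV, hder hU hYV hXU]
  have hinj := (isInvertible_mfderiv_extChartAt (mem_extChartAt_source (I := J) (f p))).injective
  exact hinj ((mfderiv_comp_apply p hφd.self_of_nhds hfp _).symm.trans key)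

end LieBracket
section NijenhuisTorsion

variable {E : Type*} [NormedAddCommGroup E] [NormedSpace ℝ E]
  {H : Type*} [TopologicalSpace H] {I : ModelWithCorners ℝ E H}
  {M : Type*} [TopologicalSpace M] [ChartedSpace H M]
  {A : ∀ q : M, TangentSpace I q →L[ℝ] TangentSpace I q} {X Y : ∀ q : M, TangentSpace I q} {q : M}

lemma nijenhuisTorsion_swap :
    nijenhuisTorsion I A X Y q = -nijenhuisTorsion I A Y X q := by
  simp only [nijenhuisTorsion]
  rw [mlieBracket_swap_apply (V := fun r ↦ A r (X r)) (W := fun r ↦ A r (Y r)),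
    mlieBracket_swap_apply (V := X) (W := Y),
    mlieBracket_swap_apply (V := fun r ↦ A r (X r)) (W := Y),
    mlieBracket_swap_apply (V := X) (W := fun r ↦ A r (Y r))]
  simp only [map_neg]
  abel

lemma nijenhuisTorsion_self : nijenhuisTorsion I A X X q = 0 := by
  have h := nijenhuisTorsion_swap (A := A) (X := X) (Y := X) (q := q)
  rw [eq_neg_iff_add_eq_zero, ← two_smul ℝ, smul_eq_zero] at h
  exact h.resolve_left two_ne_zero

variable [CompleteSpace E] [IsManifold I 2 M]

/-- The Nijenhuis torsion is a tensor. -/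
lemma nijenhuisTorsion_tensorial_left
    (hA : ∀ X : ∀ q : M, TangentSpace I q, MDiffAt (T% X) q → MDiffAt (T% fun r ↦ A r (X r)) q)
    (Y : ∀ q : M, TangentSpace I q) :
    TensorialAt I E (fun X ↦ nijenhuisTorsion I A X Y q) q where
  smul {f X} hf hX := by
    have h : (fun r ↦ A r ((f • X) r)) = f • fun r ↦ A r (X r) := by
      ext r; simp
    simp only [nijenhuisTorsion, h]
    rw [mlieBracket_smul_left hf (hA X hX), mlieBracket_smul_left hf hX,
      mlieBracket_smul_left hf (hA X hX), mlieBracket_smul_left hf hX]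
    simp only [map_add, map_smul, smul_add, smul_sub]
    module
  add {X X'} hX hX' := by
    have h : (fun r ↦ A r ((X + X') r)) = (fun r ↦ A r (X r)) + fun r ↦ A r (X' r) := by
      ext r; simp
    simp only [nijenhuisTorsion, h]
    rw [mlieBracket_add_left (hA X hX) (hA X' hX'), mlieBracket_add_left hX hX',
      mlieBracket_add_left (hA X hX) (hA X' hX'), mlieBracket_add_left hX hX']
    simp only [map_add]
    abel

lemma nijenhuisTorsion_tensorial_right
    (hA : ∀ X : ∀ q : M, TangentSpace I q, MDiffAt (T% X) q → MDiffAt (T% fun r ↦ A r (X r)) q)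
    (X : ∀ q : M, TangentSpace I q) :
    TensorialAt I E (fun Y ↦ nijenhuisTorsion I A X Y q) q where
  smul {f Y} hf hY := by
    rw [nijenhuisTorsion_swap, (nijenhuisTorsion_tensorial_left hA X).smul hf hY,
      nijenhuisTorsion_swap (X := X) (Y := Y), smul_neg]
  add {Y Y'} hY hY' := by
    rw [nijenhuisTorsion_swap, (nijenhuisTorsion_tensorial_left hA X).add hY hY',
      nijenhuisTorsion_swap (X := X) (Y := Y), nijenhuisTorsion_swap (X := X) (Y := Y'), neg_add]

end NijenhuisTorsion

section Cone

open Filter Topology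

variable {E : Type*} [NormedAddCommGroup E] [NormedSpace ℝ E]
  {M : Type*} [TopologicalSpace M] [ChartedSpace E M]

lemma mvfderiv_comp_fst {f : M → ℝ} {q : M × ℝ} (hf : MDiffAt f q.1) (v : TangentSpace (𝓘(ℝ, E).prod 𝓘(ℝ, ℝ)) q) :
    mvfderiv (𝓘(ℝ, E).prod 𝓘(ℝ, ℝ)) (fun r ↦ f r.1) q v = mvfderiv 𝓘(ℝ, E) f q.1 (show E × ℝ from v).1 := by
  have h := mvfderiv_comp_apply q hf (mdifferentiableAt_fst (I := 𝓘(ℝ, E)) (I' := 𝓘(ℝ, ℝ))) v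
  rw [mfderiv_fst] at h
  exact h

lemma mvfderiv_snd (q : M × ℝ) (v : TangentSpace (𝓘(ℝ, E).prod 𝓘(ℝ, ℝ)) q) :
    mvfderiv (𝓘(ℝ, E).prod 𝓘(ℝ, ℝ)) (fun r : M × ℝ ↦ r.2) q v = (show E × ℝ from v).2 := by
  have h : mfderiv (𝓘(ℝ, E).prod 𝓘(ℝ, ℝ)) 𝓘(ℝ, ℝ) (fun r : M × ℝ ↦ r.2) q = _ := mfderiv_snd
  rw [mvfderiv, h]
  rfl

/-- The lift to `M × ℝ` of a vector field on `M`. -/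
def coneLift (U : ∀ p : M, TangentSpace 𝓘(ℝ, E) p) (q : M × ℝ) : TangentSpace (𝓘(ℝ, E).prod 𝓘(ℝ, ℝ)) q :=
  ((U q.1, 0) : E × ℝ)

/-- The radial vector field `r ∂/∂r` on `M × ℝ`. -/
def radialField (q : M × ℝ) : TangentSpace (𝓘(ℝ, E).prod 𝓘(ℝ, ℝ)) q := ((0, q.2) : E × ℝ)

variable [IsManifold 𝓘(ℝ, E) ∞ M]

lemma mdifferentiableAt_prodMk {U : ∀ q : M × ℝ, TangentSpace 𝓘(ℝ, E) q.1} {a : M × ℝ → ℝ}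
    {q : M × ℝ} (hU : MDifferentiableAt (𝓘(ℝ, E).prod 𝓘(ℝ, ℝ)) 𝓘(ℝ, E).tangent
      (fun r ↦ (⟨r.1, U r⟩ : TangentBundle 𝓘(ℝ, E) M)) q)
    (ha : MDifferentiableAt (𝓘(ℝ, E).prod 𝓘(ℝ, ℝ)) 𝓘(ℝ, ℝ) a q) :
    MDifferentiableAt (𝓘(ℝ, E).prod 𝓘(ℝ, ℝ)) (𝓘(ℝ, E).prod 𝓘(ℝ, ℝ)).tangent
      (fun r ↦ (⟨r, ((U r, a r) : E × ℝ)⟩ : TangentBundle (𝓘(ℝ, E).prod 𝓘(ℝ, ℝ)) (M × ℝ))) q := by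
  have h1 : MDifferentiableAt (𝓘(ℝ, E).prod 𝓘(ℝ, ℝ)) 𝓘(ℝ, ℝ).tangent
      (fun r : M × ℝ ↦ (⟨r.2, a r⟩ : TangentBundle 𝓘(ℝ, ℝ) ℝ)) q := by
    rw [mdifferentiableAt_totalSpace]
    refine ⟨mdifferentiableAt_snd, ?_⟩
    simpa using ha
  have h2 := (contMDiff_equivTangentBundleProd_symm (I := 𝓘(ℝ, E)) (M := M) (I' := 𝓘(ℝ, ℝ))
    (M' := ℝ) (n := 1)).mdifferentiable (by simp)
  exact (h2 _).comp q (hU.prodMk h1)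

lemma mdifferentiableAt_fst_section {X : ∀ q : M × ℝ, TangentSpace (𝓘(ℝ, E).prod 𝓘(ℝ, ℝ)) q} {q : M × ℝ}
    (hX : MDiffAt (T% X) q) : MDifferentiableAt (𝓘(ℝ, E).prod 𝓘(ℝ, ℝ)) 𝓘(ℝ, E).tangent
      (fun r ↦ (⟨r.1, (show E × ℝ from X r).1⟩ : TangentBundle 𝓘(ℝ, E) M)) q := by
  have h2 := (contMDiff_equivTangentBundleProd (I := 𝓘(ℝ, E)) (M := M) (I' := 𝓘(ℝ, ℝ))
    (M' := ℝ) (n := 1)).mdifferentiable (by simp)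
  exact ((h2 _).comp q hX).fst

lemma mdifferentiableAt_snd_section {X : ∀ q : M × ℝ, TangentSpace (𝓘(ℝ, E).prod 𝓘(ℝ, ℝ)) q} {q : M × ℝ}
    (hX : MDiffAt (T% X) q) :
    MDifferentiableAt (𝓘(ℝ, E).prod 𝓘(ℝ, ℝ)) 𝓘(ℝ, ℝ) (fun r ↦ (show E × ℝ from X r).2) q := by
  have h2 := (contMDiff_equivTangentBundleProd (I := 𝓘(ℝ, E)) (M := M) (I' := 𝓘(ℝ, ℝ))
    (M' := ℝ) (n := 1)).mdifferentiable (by simp)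
  have h3 := ((h2 _).comp q hX).snd
  rw [mdifferentiableAt_totalSpace] at h3
  simpa using h3.2

lemma mdifferentiableAt_radialField (q : M × ℝ) :
    MDiffAt (T% (radialField (E := E) (M := M))) q := by
  have h := (mdifferentiable_zeroSection (IB := 𝓘(ℝ, E)) (F := E) ℝ
    (TangentSpace 𝓘(ℝ, E) : M → Type _) q.1).comp q
    (mdifferentiableAt_fst (I := 𝓘(ℝ, E)) (I' := 𝓘(ℝ, ℝ)) (M' := ℝ))
  exact mdifferentiableAt_prodMk h mdifferentiableAt_snd

lemma mdifferentiableAt_coneLift {U : ∀ p : M, TangentSpace 𝓘(ℝ, E) p} {q : M × ℝ}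
    (hU : MDiffAt (T% U) q.1) : MDiffAt (T% (coneLift U)) q :=
  mdifferentiableAt_prodMk (hU.comp q mdifferentiableAt_fst) mdifferentiableAt_const

variable [CompleteSpace E]

lemma fst_mlieBracket {X Y : ∀ q : M × ℝ, TangentSpace (𝓘(ℝ, E).prod 𝓘(ℝ, ℝ)) q} {U V : ∀ p : M, TangentSpace 𝓘(ℝ, E) p}
    {q : M × ℝ} (hX : MDiffAt (T% X) q) (hY : MDiffAt (T% Y) q) (hU : MDiffAt (T% U) q.1)
    (hV : MDiffAt (T% V) q.1) (hXU : ∀ r, (show E × ℝ from X r).1 = U r.1)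
    (hYV : ∀ r, (show E × ℝ from Y r).1 = V r.1) :
    (show E × ℝ from mlieBracket (𝓘(ℝ, E).prod 𝓘(ℝ, ℝ)) X Y q).1 = mlieBracket 𝓘(ℝ, E) U V q.1 := by
  have : IsManifold 𝓘(ℝ, E) 2 M := .of_le (n := ∞) (by norm_cast)
  have h := mfderiv_apply_mlieBracket_of_related (f := Prod.fst) (p := q) contMDiffAt_fst hX hY hU hV
    (.of_forall fun r ↦ by rw [mfderiv_fst]; exact hXU r)
    (.of_forall fun r ↦ by rw [mfderiv_fst]; exact hYV r)
  rw [mfderiv_fst] at h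
  exact h

lemma snd_mlieBracket {X Y : ∀ q : M × ℝ, TangentSpace (𝓘(ℝ, E).prod 𝓘(ℝ, ℝ)) q} {q : M × ℝ}
    (hX : MDiffAt (T% X) q) (hY : MDiffAt (T% Y) q) :
    (show E × ℝ from mlieBracket (𝓘(ℝ, E).prod 𝓘(ℝ, ℝ)) X Y q).2 =
      mvfderiv (𝓘(ℝ, E).prod 𝓘(ℝ, ℝ)) (fun r ↦ (show E × ℝ from Y r).2) q (X q)
        - mvfderiv (𝓘(ℝ, E).prod 𝓘(ℝ, ℝ)) (fun r ↦ (show E × ℝ from X r).2) q (Y q) := by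
  have : IsManifold 𝓘(ℝ, E) 2 M := .of_le (n := ∞) (by norm_cast)
  have h := mvfderiv_apply_mlieBracket (f := fun r : M × ℝ ↦ r.2) contMDiffAt_snd hX hY
  simpa only [mvfderiv_snd] using h

lemma mlieBracket_coneLift {U V : ∀ p : M, TangentSpace 𝓘(ℝ, E) p} {q : M × ℝ}
    (hU : MDiffAt (T% U) q.1) (hV : MDiffAt (T% V) q.1) :
    mlieBracket (𝓘(ℝ, E).prod 𝓘(ℝ, ℝ)) (coneLift U) (coneLift V) q = coneLift (mlieBracket 𝓘(ℝ, E) U V) q := by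
  refine Prod.ext (fst_mlieBracket (mdifferentiableAt_coneLift hU) (mdifferentiableAt_coneLift hV)
    hU hV (fun _ ↦ rfl) fun _ ↦ rfl)
    ((snd_mlieBracket (mdifferentiableAt_coneLift hU) (mdifferentiableAt_coneLift hV)).trans ?_)
  simp only [coneLift, mvfderiv_const]
  exact sub_zero 0

lemma mlieBracket_coneLift_radialField {U : ∀ p : M, TangentSpace 𝓘(ℝ, E) p}
    {q : M × ℝ} (hU : MDiffAt (T% U) q.1) : mlieBracket (𝓘(ℝ, E).prod 𝓘(ℝ, ℝ)) (coneLift U) radialField q = 0 := by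
  refine Prod.ext ((fst_mlieBracket (V := 0) (mdifferentiableAt_coneLift hU)
    (mdifferentiableAt_radialField q) hU (mdifferentiable_zeroSection ..)
    (fun _ ↦ rfl) fun _ ↦ rfl).trans ?_)
    ((snd_mlieBracket (mdifferentiableAt_coneLift hU) (mdifferentiableAt_radialField q)).trans ?_)
  · rw [mlieBracket_zero_right]
    rfl
  · exact (congrArg₂ (· - ·) (mvfderiv_snd q (coneLift U q))
      congr($(mvfderiv_const (0 : ℝ)) (radialField q))).trans (sub_zero (0 : ℝ))

end Cone

section Normality

open Filter Topology

variable {E : Type*} [NormedAddCommGroup E] [NormedSpace ℝ E]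
  {M : Type*} [TopologicalSpace M] [ChartedSpace E M] [IsManifold 𝓘(ℝ, E) ∞ M]

namespace AlmostContactStructure

variable (S : AlmostContactStructure E M)

lemma coneJ_apply (q : M × ℝ) (v : E × ℝ) :
    S.coneJ q v = ((S.phi q.1 v.1 - (q.2⁻¹ * v.2) • S.xi q.1, q.2 * S.eta q.1 v.1) : E × ℝ) :=
  rfl

lemma coneJ_coneLift (U : ∀ p : M, TangentSpace 𝓘(ℝ, E) p) (q : M × ℝ) :
    S.coneJ q (coneLift U q) = coneLift (fun p ↦ S.phi p (U p)) q
      + S.eta q.1 (U q.1) • radialField q := by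
  refine (S.coneJ_apply q _).trans (Prod.ext ?_ ?_)
  · change S.phi q.1 (U q.1) - (q.2⁻¹ * 0) • S.xi q.1 =
      S.phi q.1 (U q.1) + S.eta q.1 (U q.1) • (0 : TangentSpace 𝓘(ℝ, E) q.1)
    simp
  · change q.2 * S.eta q.1 (U q.1) = 0 + S.eta q.1 (U q.1) * q.2
    ring

lemma coneJ_radialField {q : M × ℝ} (hq : q.2 ≠ 0) :
    S.coneJ q (radialField q) = (-1 : ℝ) • coneLift S.xi q := by
  refine (S.coneJ_apply q _).trans (Prod.ext ?_ ?_)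
  · change S.phi q.1 0 - (q.2⁻¹ * q.2) • S.xi q.1 = (-1 : ℝ) • S.xi q.1
    simp [hq]
  · change q.2 * S.eta q.1 0 = -1 * 0
    simp

lemma coneJ_coneJ {q : M × ℝ} (hq : q.2 ≠ 0) (v : TangentSpace (𝓘(ℝ, E).prod 𝓘(ℝ, ℝ)) q) :
    S.coneJ q (S.coneJ q v) = -v := by
  obtain ⟨(u : TangentSpace 𝓘(ℝ, E) q.1), a⟩ := v
  refine (S.coneJ_apply q _).trans (Prod.ext ?_ ?_)
  · change S.phi q.1 (S.phi q.1 u - (q.2⁻¹ * a) • S.xi q.1)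
      - (q.2⁻¹ * (q.2 * S.eta q.1 u)) • S.xi q.1 = -u
    rw [inv_mul_cancel_left₀ hq, map_sub, map_smul, S.phi_xi, S.phi_phi]
    simp
  · change q.2 * S.eta q.1 (S.phi q.1 u - (q.2⁻¹ * a) • S.xi q.1) = -a
    rw [map_sub, map_smul, S.eta_phi, S.eta_xi]
    simp [hq]

lemma mdifferentiableAt_coneJ {X : ∀ q : M × ℝ, TangentSpace (𝓘(ℝ, E).prod 𝓘(ℝ, ℝ)) q} {q : M × ℝ} (hq : q.2 ≠ 0)
    (hX : MDiffAt (T% X) q) : MDiffAt (T% fun r ↦ S.coneJ r (X r)) q := by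
  have h1 := mdifferentiableAt_fst_section hX
  have h2 := mdifferentiableAt_snd_section hX
  have hφ : MDifferentiableAt (𝓘(ℝ, E).prod 𝓘(ℝ, ℝ)) 𝓘(ℝ, E).tangent (fun r ↦
      (⟨r.1, S.phi r.1 (show E × ℝ from X r).1⟩ : TangentBundle 𝓘(ℝ, E) M)) q :=
    MDifferentiableAt.clm_bundle_apply (F₁ := E) (F₂ := E) (b := Prod.fst)
      (((S.phi_smooth q.1).mdifferentiableAt (by simp)).comp q mdifferentiableAt_fst) h1
  have hη : MDifferentiableAt (𝓘(ℝ, E).prod 𝓘(ℝ, ℝ)) 𝓘(ℝ, ℝ)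
      (fun r ↦ S.eta r.1 (show E × ℝ from X r).1) q := by
    have := MDifferentiableAt.clm_bundle_apply (F₁ := E) (F₂ := ℝ) (E₂ := Bundle.Trivial M ℝ)
      (b := Prod.fst)
      (((S.eta_smooth q.1).mdifferentiableAt (by simp)).comp q mdifferentiableAt_fst) h1
    rw [mdifferentiableAt_totalSpace] at this
    exact this.2
  have hr : MDifferentiableAt (𝓘(ℝ, E).prod 𝓘(ℝ, ℝ)) 𝓘(ℝ, ℝ) (fun r : M × ℝ ↦ r.2) q :=
    mdifferentiableAt_snd
  have hinv : MDifferentiableAt (𝓘(ℝ, E).prod 𝓘(ℝ, ℝ)) 𝓘(ℝ, ℝ) (fun r : M × ℝ ↦ r.2⁻¹) q :=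
    (differentiableAt_inv hq).mdifferentiableAt.comp q hr
  have h3 := mdifferentiableAt_prodMk hφ (hr.mul hη)
  have h4 := (hinv.mul h2).smul_section
    (mdifferentiableAt_coneLift (q := q) (S.mdifferentiableAt_xi q.1))
  refine (mdifferentiableAt_sub_section h3 h4).congr_of_eventuallyEq (.of_forall fun r ↦ ?_)
  refine congrArg (TotalSpace.mk r) ((S.coneJ_apply r _).trans (Prod.ext rfl ?_))
  change _ = r.2 * _ - (r.2⁻¹ * _) * 0
  rw [mul_zero, sub_zero]

end AlmostContactStructure

namespace AlmostContactComplexRiemannian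

variable [FiniteDimensional ℝ E] {S : AlmostContactComplexRiemannian E M}

lemma IsSasakiLike.nijenhuisTorsion_coneJ_coneLift_radialField (hS : S.IsSasakiLike)
    {U : ∀ p : M, TangentSpace 𝓘(ℝ, E) p} {q : M × ℝ} (hq : q.2 ≠ 0) (hU : MDiffAt (T% U) q.1) :
    nijenhuisTorsion (𝓘(ℝ, E).prod 𝓘(ℝ, ℝ)) S.coneJ (coneLift U) radialField q = 0 := by
  have := FiniteDimensional.complete ℝ E
  let h : M × ℝ → ℝ := fun r ↦ S.eta r.1 (U r.1)
  have hh : MDiffAt h q := (S.mdifferentiableAt_eta_apply hU).comp q mdifferentiableAt_fst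
  have hξ := S.mdifferentiableAt_xi q.1
  have hφU := S.mdifferentiableAt_phi hU
  have hlU := mdifferentiableAt_coneLift hU
  have hlξ := mdifferentiableAt_coneLift hξ
  have hlφU := mdifferentiableAt_coneLift hφU
  have hD := mdifferentiableAt_radialField (E := E) q
  have hJU : (fun r ↦ S.coneJ r (coneLift U r)) =
      coneLift (fun p ↦ S.phi p (U p)) + h • radialField := by
    ext1 r
    exact S.coneJ_coneLift U r
  have hJD : (fun r : M × ℝ ↦ S.coneJ r (radialField r)) =ᶠ[𝓝 q]
      (-1 : ℝ) • coneLift S.xi := by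
    filter_upwards [(continuous_snd.continuousAt.eventually_ne hq)] with r hr
    exact S.coneJ_radialField hr
  have hDξ : mlieBracket (𝓘(ℝ, E).prod 𝓘(ℝ, ℝ)) radialField (coneLift S.xi) q = 0 := by
    rw [mlieBracket_swap_apply, mlieBracket_coneLift_radialField hξ, neg_zero]
  have dhD : mvfderiv (𝓘(ℝ, E).prod 𝓘(ℝ, ℝ)) h q (radialField q) = 0 :=
    (mvfderiv_comp_fst (S.mdifferentiableAt_eta_apply hU) _).trans (map_zero _)
  have dhξ : mvfderiv (𝓘(ℝ, E).prod 𝓘(ℝ, ℝ)) h q (coneLift S.xi q) =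
      S.eta q.1 (mlieBracket 𝓘(ℝ, E) S.xi U q.1) := by
    have h1 := hS.dEta_eq_zero hξ hU
    simp only [AlmostContactStructure.dEta, S.eta_xi, mvfderiv_const] at h1
    have h2 := mvfderiv_comp_fst (S.mdifferentiableAt_eta_apply hU) (coneLift S.xi q)
    rw [zero_apply, sub_zero, sub_eq_zero] at h1
    exact h2.trans h1
  rw [nijenhuisTorsion, hJU, Filter.EventuallyEq.rfl.mlieBracket_vectorField_eq hJD,
    Filter.EventuallyEq.rfl.mlieBracket_vectorField_eq hJD,
    mlieBracket_const_smul_right hlξ, mlieBracket_const_smul_right hlξ,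
    mlieBracket_add_left hlφU (hh.smul_section hD), mlieBracket_add_left hlφU (hh.smul_section hD),
    mlieBracket_smul_left hh hD, mlieBracket_smul_left hh hD, mlieBracket_coneLift_radialField hφU,
    mlieBracket_coneLift_radialField hU, mlieBracket_coneLift hφU hξ, mlieBracket_coneLift hU hξ,
    hDξ, mlieBracket_self, dhD, dhξ, map_smul, S.coneJ_coneLift]
  have e1 : coneLift (mlieBracket 𝓘(ℝ, E) (fun p ↦ S.phi p (U p)) S.xi) q =
      coneLift (fun p ↦ S.phi p (mlieBracket 𝓘(ℝ, E) U S.xi p)) q :=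
    congrArg (fun u : E ↦ ((u, 0) : E × ℝ)) (hS.mlieBracket_phi_xi hU)
  rw [e1, mlieBracket_swap_apply (V := S.xi), map_neg]
  simp only [map_zero, Pi.zero_apply]
  simp only [map_zero, smul_zero, neg_zero, zero_smul, add_zero]
  module

lemma IsSasakiLike.nijenhuisTorsion_coneJ_coneLift (hS : S.IsSasakiLike)
    {U V : ∀ p : M, TangentSpace 𝓘(ℝ, E) p} {q : M × ℝ} (hq : q.2 ≠ 0) (hU : MDiffAt (T% U) q.1)
    (hV : MDiffAt (T% V) q.1) :
    nijenhuisTorsion (𝓘(ℝ, E).prod 𝓘(ℝ, ℝ)) S.coneJ (coneLift U) (coneLift V) q = 0 := by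
  have := FiniteDimensional.complete ℝ E
  have hlift (U : ∀ p : M, TangentSpace 𝓘(ℝ, E) p) : (fun r ↦ S.coneJ r (coneLift U r)) =
      coneLift (fun p ↦ S.phi p (U p)) + (fun r : M × ℝ ↦ S.eta r.1 (U r.1)) • radialField := by
    ext1 r
    exact S.coneJ_coneLift U r
  have hh {U : ∀ p : M, TangentSpace 𝓘(ℝ, E) p} (hU : MDiffAt (T% U) q.1) :
      MDiffAt (fun r : M × ℝ ↦ S.eta r.1 (U r.1)) q :=
    (S.mdifferentiableAt_eta_apply hU).comp q mdifferentiableAt_fst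
  have hφU := S.mdifferentiableAt_phi hU
  have hφV := S.mdifferentiableAt_phi hV
  have hlU := mdifferentiableAt_coneLift hU
  have hlV := mdifferentiableAt_coneLift hV
  have hlφU := mdifferentiableAt_coneLift hφU
  have hlφV := mdifferentiableAt_coneLift hφV
  have hD := mdifferentiableAt_radialField (E := E) q
  have hDl {W : ∀ p : M, TangentSpace 𝓘(ℝ, E) p} (hW : MDiffAt (T% W) q.1) :
      mlieBracket (𝓘(ℝ, E).prod 𝓘(ℝ, ℝ)) radialField (coneLift W) q = 0 := by
    rw [mlieBracket_swap_apply, mlieBracket_coneLift_radialField hW, neg_zero]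
  have dh {W : ∀ p : M, TangentSpace 𝓘(ℝ, E) p} (hW : MDiffAt (T% W) q.1)
      (Z : ∀ p : M, TangentSpace 𝓘(ℝ, E) p) :
      mvfderiv (𝓘(ℝ, E).prod 𝓘(ℝ, ℝ)) (fun r : M × ℝ ↦ S.eta r.1 (W r.1)) q (coneLift Z q) =
        mvfderiv 𝓘(ℝ, E) (fun p ↦ S.eta p (W p)) q.1 (Z q.1) :=
    mvfderiv_comp_fst (S.mdifferentiableAt_eta_apply hW) _
  have dhD {W : ∀ p : M, TangentSpace 𝓘(ℝ, E) p} (hW : MDiffAt (T% W) q.1) :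
      mvfderiv (𝓘(ℝ, E).prod 𝓘(ℝ, ℝ)) (fun r : M × ℝ ↦ S.eta r.1 (W r.1)) q (radialField q) = 0 :=
    (mvfderiv_comp_fst (S.mdifferentiableAt_eta_apply hW) _).trans (map_zero _)
  have d1 := hS.dEta_eq_zero hU hV
  have d2 := hS.dEta_eq_zero hφU hV
  have d3 := hS.dEta_eq_zero hU hφV
  simp only [AlmostContactStructure.dEta, S.eta_phi, mvfderiv_const, zero_apply] at d1 d2 d3
  have hN := hS.nijenhuisTorsion_phi_eq_zero hU hV
  rw [nijenhuisTorsion, S.phi_phi] at hN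
  have b1 : mlieBracket (𝓘(ℝ, E).prod 𝓘(ℝ, ℝ)) (coneLift (fun p ↦ S.phi p (U p)) + (fun r : M × ℝ ↦ S.eta r.1 (U r.1)) •
      radialField) (coneLift (fun p ↦ S.phi p (V p)) + (fun r : M × ℝ ↦ S.eta r.1 (V r.1)) •
      radialField) q =
      coneLift (mlieBracket 𝓘(ℝ, E) (fun p ↦ S.phi p (U p)) fun p ↦ S.phi p (V p)) q
        + mvfderiv 𝓘(ℝ, E) (fun p ↦ S.eta p (V p)) q.1 (S.phi q.1 (U q.1)) • radialField q
        - mvfderiv 𝓘(ℝ, E) (fun p ↦ S.eta p (U p)) q.1 (S.phi q.1 (V q.1)) • radialField q := by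
    have hUD := (hh hU).smul_section hD
    have hVD := (hh hV).smul_section hD
    rw [mlieBracket_add_left hlφU hUD, mlieBracket_add_right hlφV hVD,
      mlieBracket_add_right hlφV hVD, mlieBracket_smul_left (hh hU) hD,
      mlieBracket_smul_left (hh hU) hD, mlieBracket_smul_right (hh hV) hD,
      mlieBracket_smul_right (hh hV) hD, mlieBracket_coneLift hφU hφV,
      mlieBracket_coneLift_radialField hφU, hDl hφV, mlieBracket_self, dh hV, dh hU, dhD hV,
      Pi.smul_apply', map_smul, dhD hU]
    simp only [Pi.zero_apply, smul_zero, zero_smul, neg_zero, add_zero]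
    module
  have b2 : mlieBracket (𝓘(ℝ, E).prod 𝓘(ℝ, ℝ)) (coneLift (fun p ↦ S.phi p (U p)) + (fun r : M × ℝ ↦ S.eta r.1 (U r.1)) •
      radialField) (coneLift V) q =
      coneLift (mlieBracket 𝓘(ℝ, E) (fun p ↦ S.phi p (U p)) V) q
        - mvfderiv 𝓘(ℝ, E) (fun p ↦ S.eta p (U p)) q.1 (V q.1) • radialField q := by
    rw [mlieBracket_add_left hlφU ((hh hU).smul_section hD), mlieBracket_smul_left (hh hU) hD,
      mlieBracket_coneLift hφU hV, hDl hV, dh hU, smul_zero, add_zero, neg_smul, sub_eq_add_neg]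
  have b3 : mlieBracket (𝓘(ℝ, E).prod 𝓘(ℝ, ℝ)) (coneLift U) (coneLift (fun p ↦ S.phi p (V p)) +
      (fun r : M × ℝ ↦ S.eta r.1 (V r.1)) • radialField) q =
      coneLift (mlieBracket 𝓘(ℝ, E) U fun p ↦ S.phi p (V p)) q
        + mvfderiv 𝓘(ℝ, E) (fun p ↦ S.eta p (V p)) q.1 (U q.1) • radialField q := by
    rw [mlieBracket_add_right hlφV ((hh hV).smul_section hD), mlieBracket_smul_right (hh hV) hD,
      mlieBracket_coneLift hU hφV, mlieBracket_coneLift_radialField hU, dh hV, smul_zero, add_zero]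
  rw [nijenhuisTorsion, hlift U, hlift V, S.coneJ_coneJ hq, b1, b2, b3,
    mlieBracket_coneLift hU hV]
  simp only [map_add, map_sub, map_smul, S.coneJ_coneLift, S.coneJ_radialField hq]
  let L : TangentSpace 𝓘(ℝ, E) q.1 →L[ℝ] TangentSpace (𝓘(ℝ, E).prod 𝓘(ℝ, ℝ)) q := ContinuousLinearMap.inl ℝ E ℝ
  have hL (W : ∀ p : M, TangentSpace 𝓘(ℝ, E) p) : coneLift W q = L (W q.1) := rfl
  simp only [hL]
  have hN' := congrArg L hN
  simp only [map_add, map_sub, map_neg, map_smul, map_zero] at hN'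
  have e1 : S.eta q.1 (mlieBracket 𝓘(ℝ, E) U V q.1) =
    mvfderiv 𝓘(ℝ, E) (fun p ↦ S.eta p (V p)) q.1 (U q.1) -
      mvfderiv 𝓘(ℝ, E) (fun p ↦ S.eta p (U p)) q.1 (V q.1) := by linarith
  have e2 : S.eta q.1 (mlieBracket 𝓘(ℝ, E) (fun p ↦ S.phi p (U p)) V q.1) =
    mvfderiv 𝓘(ℝ, E) (fun p ↦ S.eta p (V p)) q.1 (S.phi q.1 (U q.1)) := by linarith
  have e3 : S.eta q.1 (mlieBracket 𝓘(ℝ, E) U (fun p ↦ S.phi p (V p)) q.1) =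
    -mvfderiv 𝓘(ℝ, E) (fun p ↦ S.eta p (U p)) q.1 (S.phi q.1 (V q.1)) := by linarith
  rw [e1] at hN'
  rw [e2, e3, ← hN']
  module

/-- A Sasaki-like structure is normal. -/
theorem IsSasakiLike.isNormal (hS : S.IsSasakiLike) : S.IsNormal := by
  intro q hq X Y hX hY
  have := FiniteDimensional.complete ℝ E
  have hJ (X : ∀ q : M × ℝ, TangentSpace (𝓘(ℝ, E).prod 𝓘(ℝ, ℝ)) q) (hX : MDiffAt (T% X) q) :
      MDiffAt (T% fun r ↦ S.coneJ r (X r)) q := S.mdifferentiableAt_coneJ hq hX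
  have tL := nijenhuisTorsion_tensorial_left hJ
  have tR := nijenhuisTorsion_tensorial_right hJ
  have hD := mdifferentiableAt_radialField (E := E) q
  have frame (w : TangentSpace (𝓘(ℝ, E).prod 𝓘(ℝ, ℝ)) q) : ∃ (U : ∀ p : M, TangentSpace 𝓘(ℝ, E) p) (a : ℝ),
      MDiffAt (T% U) q.1 ∧ coneLift U q + a • radialField q = w := by
    obtain ⟨(u : TangentSpace 𝓘(ℝ, E) q.1), a⟩ := w
    refine ⟨FiberBundle.extend E u, a * q.2⁻¹, FiberBundle.mdifferentiableAt_extend .., ?_⟩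
    refine Prod.ext ?_ ?_
    · change FiberBundle.extend E u q.1 + (a * q.2⁻¹) • (0 : TangentSpace 𝓘(ℝ, E) q.1) = u
      simp
    · change 0 + a * q.2⁻¹ * q.2 = a
      field_simp
      ring
  obtain ⟨U, a, hU, hUX⟩ := frame (X q)
  obtain ⟨V, b, hV, hVY⟩ := frame (Y q)
  have hlU := mdifferentiableAt_coneLift hU
  have hlV := mdifferentiableAt_coneLift hV
  have ha : MDiffAt (fun _ : M × ℝ ↦ a) q := mdifferentiableAt_const
  have hb : MDiffAt (fun _ : M × ℝ ↦ b) q := mdifferentiableAt_const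
  have haD := ha.smul_section hD
  have hbD := hb.smul_section hD
  rw [TensorialAt.pointwise₂ (fun Y _ ↦ tL Y) (fun X _ ↦ tR X) (hX.mdifferentiableAt (by simp))
    (mdifferentiableAt_add_section hlU haD) (hY.mdifferentiableAt (by simp))
    (mdifferentiableAt_add_section hlV hbD) hUX.symm hVY.symm,
    (tL _).add hlU haD, (tL _).smul ha hD, (tR _).add hlV hbD, (tR _).add hlV hbD,
    (tR _).smul hb hD, (tR _).smul hb hD, nijenhuisTorsion_self,
    nijenhuisTorsion_swap (X := radialField), hS.nijenhuisTorsion_coneJ_coneLift hq hU hV,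
    hS.nijenhuisTorsion_coneJ_coneLift_radialField hq hU,
    hS.nijenhuisTorsion_coneJ_coneLift_radialField hq hV]
  simp

end AlmostContactComplexRiemannian

end Normality

end SasakiLike

theorem corollary3p4 {E : Type*} [NormedAddCommGroup E] [NormedSpace ℝ E] [FiniteDimensional ℝ E]
    {M : Type*} [TopologicalSpace M] [ChartedSpace E M] [IsManifold 𝓘(ℝ, E) ∞ M]
    (n : ℕ) (hn : Module.finrank ℝ E = 2 * n + 1)
    (S : SasakiLike.AlmostContactComplexRiemannian E M) (hS : S.IsSasakiLike) :
    S.IsNormal ∧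
    (∀ (p : M) (X Y : ∀ q : M, TangentSpace 𝓘(ℝ, E) q),
      ContMDiffAt 𝓘(ℝ, E) 𝓘(ℝ, E).tangent ∞ (T% X) p →
      ContMDiffAt 𝓘(ℝ, E) 𝓘(ℝ, E).tangent ∞ (T% Y) p →
      S.nijenhuis X Y p = 0) ∧
    (∀ (p : M) (X Y : ∀ q : M, TangentSpace 𝓘(ℝ, E) q),
      ContMDiffAt 𝓘(ℝ, E) 𝓘(ℝ, E).tangent ∞ (T% X) p →
      ContMDiffAt 𝓘(ℝ, E) 𝓘(ℝ, E).tangent ∞ (T% Y) p →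
      S.dEta X Y p = 0) ∧
    (∀ p : M, S.g.leviCivita S.xi p (S.xi p) = 0) ∧
    (∀ (γ : ℝ → M) (s : Set ℝ), IsOpen s → IsMIntegralCurveOn γ S.xi s →
      SasakiLike.IsGeodesicOn S.g.leviCivita γ s) ∧
    (∀ (p : M) (e : Fin n ⊕ Fin n → TangentSpace 𝓘(ℝ, E) p), S.IsAdaptedBasis p e →
      ∀ z : TangentSpace 𝓘(ℝ, E) p,
        S.theta p e z = -2 * n * S.eta p z ∧ S.thetaStar p e z = 0) := by
  exact ⟨hS.isNormal,
    fun p X Y hX hY ↦ hS.nijenhuis_eq_zero (hX.mdifferentiableAt (by simp))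
      (hY.mdifferentiableAt (by simp)),
    fun p X Y hX hY ↦ hS.dEta_eq_zero (hX.mdifferentiableAt (by simp))
      (hY.mdifferentiableAt (by simp)),
    hS.leviCivita_xi_xi,
    fun γ s hs hγ ↦ SasakiLike.isGeodesicOn_of_isMIntegralCurveOn S.xi_smooth
      hS.leviCivita_xi_xi hs hγ,
    fun p e he z ↦ ⟨hS.theta_eq he z, hS.thetaStar_eq_zero he z⟩⟩
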